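/- Fix a horizon $T\ge 1$. Consider the linear system $x_{t+1}=A_tx_t+B_tu_t+D_tw_t$, $t=0,\dots,T-1$, with $x_t\in\mathbb R^m$, $u_t\in\mathbb R^n$ ($n\ge1$), $w_t\in\mathbb R^k$, random $x_0\sim\mathcal D$, and noises $w_0,\dots,w_{T-1}$ independent of each other and of $x_0$; let $Q_t\in\mathbb R^{m\times m}$ ($0\le t\le T$) and $R_t\in\mathbb R^{n\times n}$ ($0\le t\le T-1$) be symmetric positive definite. Write $\widehat x_t=(x_t^\top,1)^\top$, and for augmented affine gains $\widehat K=(\widehat K_0,\dots,\widehat K_{T-1})$, $\widehat K_t=[K_t\ L_t]\in\mathbb R^{n\times(m+1)}$, use the policy $u_t=-\widehat K_t\widehat x_t=-K_tx_t-L_t$. Let $$C(\widehat K)=\mathbb E\Big[\sum_{t=0}^{T-1}(x_t^\top Q_tx_t+u_t^\top R_tu_t)+x_T^\top Q_Tx_T\Big],\qquad \Sigma_t=\mathbb E[\widehat x_t\widehat x_t^\top],\qquad \Sigma_{\widehat K}=\sum_{t=0}^T\Sigma_t ,$$ let $\widehat K^*$ denote a minimizer of $C$, and let $\|\cdot\|$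 be the spectral norm. For an initial gain $\widehat K^0$ let $\underline\sigma_X$ be the infimum of the smallest singular values $\sigma_{\min}(\Sigma_t)$ over $0\le t\le T$ and over all $\widehat K$ with $C(\widehat K)\le C(\widehat K^0)$, and let $\underline\sigma_R=\min_t\sigma_{\min}(R_t)$. The exact policy gradient iteration with constant stepsize $\eta$ is $\widehat K^{i+1}_t=\widehat K^i_t-\eta\nabla_tC(\widehat K^i)$, where $\nabla_t C$ is the gradient of $C$ in $\widehat K_t$. Then there is a real polynomial $p$, depending only on $T$, such that the following holds for all such problems and all $\widehat K^0$. Put $\eta=p\big(\tfrac1{C(\widehat K^0)+1},\ \theta,\ \tfrac1{\theta+1}\big)$, where $\theta$ runs through the parameters $m$, $n$, $k$, $\max_t\|\widehat A_t\|$, $\max_t\|\widehat B_t\|$, $\max_t\|\widehat D_t\|$, $\max_t\|\widehat Q_t\|$, $\max_t\|R_t\|$, $\max_t\|\mathbb E[w_t]\|$, $\max_t\|\mathbb E[w_tw_t^\top]\|$, $\|\mathbb E[\widehat x_0\widehat x_0^\top]\|$, $\underline\sigma_X$, $\underline\sigma_R$, with $\widehat A_t=\begin{bmatrix}A_t&0\\0&1\end{bmatrix}$,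 $\widehat B_t=\begin{bmatrix}B_t\\0\end{bmatrix}$, $\widehat D_t=\begin{bmatrix}D_t\\0\end{bmatrix}$, $\widehat Q_t=\begin{bmatrix}Q_t&0\\0&0\end{bmatrix}$. (a) If the noises have finite second moments, $C(\widehat K^0)<\infty$ and $\underline\sigma_X>0$, then $\eta>0$, a minimizer $\widehat K^*$ of $C$ exists, and for every minimizer $\widehat K^*$ and every $i\ge0$ $$C(\widehat K^{i+1})-C(\widehat K^*)\le\Big(1-2\eta\,\frac{\underline\sigma_X^2\,\underline\sigma_R}{\|\Sigma_{\widehat K^*}\|+1}\Big)\big(C(\widehat K^i)-C(\widehat K^*)\big);$$ moreover, for every $\varepsilon>0$, $C(\widehat K^N)-C(\widehat K^*)\le\varepsilon$ whenever $$N\ge\frac{\|\Sigma_{\widehat K^*}\|+1}{2\eta\,\underline\sigma_X^2\,\underline\sigma_R}\log\frac{C(\widehat K^0)-C(\widehat K^*)}{\varepsilon}.$$ This applies in particular when the law of $w_t$ is the empirical measure $\widehat{\mathbb P}_M=\frac1M\sum_{i=1}^M\delta_{\widehat w_{t,i}}$ of any data sample. (b) Let $M\ge1$, let $\mathbb P$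 be a probability measure on $\mathbb R^k$, and let the data be random, such that for each $t$ the sample $(\widehat w_{t,1},\dots,\widehat w_{t,M})$ is i.i.d. with law $\mathbb P$ (the samples of different stages may coincide or be independent). Let $C$, $\underline\sigma_X$, $\Sigma_{\widehat K}$, $\eta$, $\widehat K^i$, $\widehat K^*$ be formed with the empirical noise laws $\widehat{\mathbb P}_M$. If $C(\widehat K^0)<\infty$ and $\underline\sigma_X>0$ almost surely, then for every $\beta\in(0,1)$, with probability greater than $1-\beta$ over the data, all conclusions of (a) hold. -/

import Mathlib

open MeasureTheory Matrix
open scoped Matrix.Norms.L2Operator ENNReal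

noncomputable section

namespace AffineLQ

/-- Index set of the augmented state `(x, 1)` with `x ∈ ℝ^m`. -/
abbrev Aug (m : ℕ) : Type := Fin m ⊕ Unit

/-- Augmented affine gains `K̂ = (K̂_0, …, K̂_{T-1})`, `K̂_t = [K_t L_t] ∈ ℝ^{n × (m+1)}`. -/
abbrev Gain (m n T : ℕ) : Type := Fin T → Matrix (Fin n) (Aug m) ℝ

/-- A point of the sample space of one trajectory: initial state and noises `w_0, …, w_{T-1}`. -/
abbrev Path (m k T : ℕ) : Type := (Fin m → ℝ) × (Fin T → Fin k → ℝ)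

/-- Data of a finite horizon linear-quadratic problem with state in `ℝ^m`, control in `ℝ^n`,
noise in `ℝ^k` and horizon `T`; only the law of the noise is left out. -/
structure LQSystem (m n k T : ℕ) where
  A : Fin T → Matrix (Fin m) (Fin m) ℝ
  B : Fin T → Matrix (Fin m) (Fin n) ℝ
  D : Fin T → Matrix (Fin m) (Fin k) ℝ
  Q : Fin (T + 1) → Matrix (Fin m) (Fin m) ℝ
  R : Fin T → Matrix (Fin n) (Fin n) ℝ
  /-- law of the initial state -/
  init : Measure (Fin m → ℝ)
  Q_posDef : ∀ t, (Q t).PosDef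
  R_posDef : ∀ t, (R t).PosDef
  init_prob : IsProbabilityMeasure init

/-- The smallest singular value of a (nonempty) square matrix; Mathlib lists the singular values
in decreasing order, starting with index `0`. -/
def sigmaMin {ι : Type} [Fintype ι] [DecidableEq ι] (Z : Matrix ι ι ℝ) : ℝ :=
  (Matrix.toEuclideanLin Z).singularValues (Fintype.card ι - 1)

/-- The augmented state `(x, 1)`. -/
def augState {m : ℕ} (x : Fin m → ℝ) : Aug m → ℝ := Sum.elim x (fun _ => 1)

/-- The empirical measure `(1/M) ∑ δ_{w_i}` of a sample of size `M`. -/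
def empirical {k M : ℕ} (w : Fin M → Fin k → ℝ) : Measure (Fin k → ℝ) :=
  ((M : ℝ≥0∞)⁻¹) • ∑ i, Measure.dirac (w i)

section Model

variable {m n k T : ℕ} (S : LQSystem m n k T)

def augA (t : Fin T) : Matrix (Aug m) (Aug m) ℝ := Matrix.fromBlocks (S.A t) 0 0 1

def augB (t : Fin T) : Matrix (Aug m) (Fin n) ℝ := Matrix.fromRows (S.B t) 0

def augD (t : Fin T) : Matrix (Aug m) (Fin k) ℝ := Matrix.fromRows (S.D t) 0

def augQ (t : Fin (T + 1)) : Matrix (Aug m) (Aug m) ℝ := Matrix.fromBlocks (S.Q t) 0 0 0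

/-- The control `u_t = -K̂_t x̂_t`. -/
def control (K : Gain m n T) (t : Fin T) (x : Aug m → ℝ) : Fin n → ℝ := -(K t *ᵥ x)

/-- The augmented trajectory: `x̂_0 = (x_0, 1)`, `x̂_{t+1} = Â_t x̂_t + B̂_t u_t + D̂_t w_t`. -/
def traj (K : Gain m n T) (ω : Path m k T) (t : Fin (T + 1)) : Aug m → ℝ :=
  Fin.induction (motive := fun _ => Aug m → ℝ) (augState ω.1)
    (fun s x => augA S s *ᵥ x + augB S s *ᵥ control K s x + augD S s *ᵥ ω.2 s) t

/-- The cost of one trajectory. -/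
def pathCost (K : Gain m n T) (ω : Path m k T) : ℝ :=
  (∑ t : Fin T,
    (traj S K ω t.castSucc ⬝ᵥ augQ S t.castSucc *ᵥ traj S K ω t.castSucc
      + control K t (traj S K ω t.castSucc) ⬝ᵥ S.R t *ᵥ control K t (traj S K ω t.castSucc)))
    + traj S K ω (Fin.last T) ⬝ᵥ augQ S (Fin.last T) *ᵥ traj S K ω (Fin.last T)

variable (ν : Fin T → Measure (Fin k → ℝ))

/-- The law of initial state and noises: independent, with `w_t` distributed as `ν t`. -/
def pathLaw : Measure (Path m k T) := S.init.prod (Measure.pi ν)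

/-- The expected cost `C(K̂)`. -/
def cost (K : Gain m n T) : ℝ := ∫ ω, pathCost S K ω ∂(pathLaw S ν)

/-- The expected cost of `K̂` is finite. -/
def FiniteCost (K : Gain m n T) : Prop := Integrable (pathCost S K) (pathLaw S ν)

/-- `Σ_t = E[x̂_t x̂_tᵀ]` under the policy `K̂`. -/
def secondMoment (K : Gain m n T) (t : Fin (T + 1)) : Matrix (Aug m) (Aug m) ℝ :=
  Matrix.of fun i j => ∫ ω, traj S K ω t i * traj S K ω t j ∂(pathLaw S ν)

/-- `Σ_{K̂} = ∑_{t=0}^T Σ_t`. -/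
def aggMoment (K : Gain m n T) : Matrix (Aug m) (Aug m) ℝ := ∑ t, secondMoment S ν K t

/-- The uniform lower bound `σ_X` on the smallest singular values of the augmented second moments,
over all times and all policies that cost at most as much as the initial one. -/
def sigmaX (K₀ : Gain m n T) : ℝ :=
  ⨅ q : {K : Gain m n T // cost S ν K ≤ cost S ν K₀} × Fin (T + 1),
    sigmaMin (secondMoment S ν q.1 q.2)

/-- `σ_R = min_t σ_min(R_t)`. -/
def sigmaR : ℝ := ⨅ t : Fin T, sigmaMin (S.R t)

/-- The gradient `∇_t C(K̂)`: the matrix of partial derivatives in the entries of `K̂_t`. -/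
def grad (K : Gain m n T) (t : Fin T) : Matrix (Fin n) (Aug m) ℝ :=
  Matrix.of fun i j => lineDeriv ℝ (cost S ν) K (Pi.single t (Matrix.single i j 1))

/-- Exact policy gradient iteration with constant stepsize `η`. -/
def iter (η : ℝ) (K₀ : Gain m n T) : ℕ → Gain m n T
  | 0 => K₀
  | i + 1 => fun t => iter η K₀ i t - η • grad S ν (iter η K₀ i) t

/-- `K̂` minimizes the cost over all augmented affine gains. -/
def IsOptimal (K : Gain m n T) : Prop := ∀ K' : Gain m n T, cost S ν K ≤ cost S ν K'

/-- The mean of `w_t`, as a Euclidean vector. -/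
def noiseMean (t : Fin T) : EuclideanSpace ℝ (Fin k) :=
  WithLp.toLp 2 fun j => ∫ w, w j ∂(ν t)

/-- `Σ^w_t = E[w_t w_tᵀ]`. -/
def noiseMoment (t : Fin T) : Matrix (Fin k) (Fin k) ℝ :=
  Matrix.of fun i j => ∫ w, w i * w j ∂(ν t)

end Model

/-- Names of the model parameters that a stepsize may depend on. -/
inductive Param : Type where
  | dimState | dimControl | dimNoise
  | normA | normB | normD | normQ | normR
  | normNoiseMean | normNoiseMoment | normInitMoment
  | sigX | sigR

/-- Variables of a stepsize polynomial: `1/(C(K̂⁰)+1)`, and for each model parameter `θ` both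
`θ` and `1/(θ+1)`. -/
inductive StepVar : Type where
  | costRecip
  | value (θ : Param)
  | recip (θ : Param)

section Stepsize

variable {m n k T : ℕ} (S : LQSystem m n k T) (ν : Fin T → Measure (Fin k → ℝ))
  (K₀ : Gain m n T)

/-- Values of the model parameters; matrix norms are spectral norms, maximized over time. -/
def paramVal : Param → ℝ
  | .dimState => m
  | .dimControl => n
  | .dimNoise => k
  | .normA => ⨆ t, ‖augA S t‖
  | .normB => ⨆ t, ‖augB S t‖
  | .normD => ⨆ t, ‖augD S t‖
  | .normQ => ⨆ t, ‖augQ S t‖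
  | .normR => ⨆ t, ‖S.R t‖
  | .normNoiseMean => ⨆ t, ‖noiseMean ν t‖
  | .normNoiseMoment => ⨆ t, ‖noiseMoment ν t‖
  | .normInitMoment => ‖secondMoment S ν K₀ 0‖
  | .sigX => sigmaX S ν K₀
  | .sigR => sigmaR S

def stepVal : StepVar → ℝ
  | .costRecip => 1 / (cost S ν K₀ + 1)
  | .value θ => paramVal S ν K₀ θ
  | .recip θ => 1 / (paramVal S ν K₀ θ + 1)

/-- The stepsize that a polynomial `p` prescribes for a given problem and initial policy. -/
def stepsize (p : MvPolynomial StepVar ℝ) : ℝ := MvPolynomial.eval (stepVal S ν K₀) p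

/-- The policy gradient iteration with stepsize `η` started at `K₀` converges globally: an optimal
policy exists, and relative to any optimal policy the optimality gap contracts geometrically and
is at most `ε` after the stated number of iterations. -/
def GloballyConverges (η : ℝ) : Prop :=
  (∃ Kstar, IsOptimal S ν Kstar) ∧
  ∀ Kstar, IsOptimal S ν Kstar →
    (∀ i : ℕ, cost S ν (iter S ν η K₀ (i + 1)) - cost S ν Kstar ≤
      (1 - 2 * η * (sigmaX S ν K₀ ^ 2 * sigmaR S / (‖aggMoment S ν Kstar‖ + 1))) *
        (cost S ν (iter S ν η K₀ i) - cost S ν Kstar)) ∧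
    ∀ ε : ℝ, 0 < ε → ∀ N : ℕ,
      (‖aggMoment S ν Kstar‖ + 1) / (2 * η * sigmaX S ν K₀ ^ 2 * sigmaR S) *
          Real.log ((cost S ν K₀ - cost S ν Kstar) / ε) ≤ N →
        cost S ν (iter S ν η K₀ N) - cost S ν Kstar ≤ ε

end Stepsize

end AffineLQ

end

noncomputable section

namespace AffineLQ

/-! ### Spectral norms, traces and smallest singular values. -/

section MatrixFacts

variable {ι κ : Type} [Fintype ι] [Fintype κ]

/-! The cost sees the noise only through second moments, so the stochastic problem reduces to a
deterministic one, `MomentLQ`. As the last coordinate of the augmented state is 1, the mean of the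
noise can be moved into the system matrix; the moments then follow a linear recursion driven by the
gains (`secondMoment_succ`), and the cost is linear in them (`cost_eq`).

For this problem `performance_difference` is an exact identity: with Δ = K' - K, the cost changes by
∑ 2 tr(E Σ' Δᵀ) + tr(H Δ Σ' Δᵀ), where E and H are the residual and the one-step Hessian at K and Σ'
are the moments under K'. Two consequences carry the proof.

Gradient domination (`cost_sub_le_gradient`): H dominates σ_R, so completing the square bounds the
optimality gap by tr(E Σ' Eᵀ) / σ_R. The gradient is 2EΣ with σ_min(Σ) ≥ σ_X, so this is at most a
multiple of the squared gradient, although the cost need not be convex.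

Local smoothness (`cost_sub_le`): replacing Σ' by Σ in the first-order term costs only O(‖Δ‖²).
Hence a short gradient step lowers the cost by at least η/2 times the squared gradient.

Together these give the contraction. The constants are uniform because gains in the sublevel set of
K₀ are bounded (`StepCondition.norm_le`) and the iterates never leave that set; its compactness also
yields a minimizer. All data are bounded by powers of one number θ (`scale`) whose inverse is a
monomial in the admissible variables, so θ^-(27T+19) is a polynomial stepsize. The empirical case
holds almost surely, since empirical laws have finite second moments. -/

theorem euclidean_norm_sq (v : ι → ℝ) : ‖WithLp.toLp 2 v‖ ^ 2 = v ⬝ᵥ v := by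
  rw [EuclideanSpace.real_norm_sq_eq]
  simp [dotProduct, pow_two]

theorem dotProduct_eq_inner (v w : ι → ℝ) :
    v ⬝ᵥ w = inner ℝ (WithLp.toLp 2 v) (WithLp.toLp 2 w) := by
  simp [EuclideanSpace.inner_toLp_toLp, dotProduct_comm]

theorem dotProduct_self_nonneg' (v : ι → ℝ) : 0 ≤ v ⬝ᵥ v := by
  rw [← euclidean_norm_sq]; positivity

theorem trace_conj_eq_sum (E : Matrix κ ι ℝ) (S : Matrix ι ι ℝ) :
    (E * S * Eᵀ).trace = ∑ i, E i ⬝ᵥ S *ᵥ E i := by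
  simp only [trace, diag_apply, mul_apply, transpose_apply, dotProduct, mulVec, Finset.mul_sum,
    Finset.sum_mul]
  refine Finset.sum_congr rfl fun i _ => ?_
  rw [Finset.sum_comm]
  exact Finset.sum_congr rfl fun a _ => Finset.sum_congr rfl fun b _ => by ring

theorem trace_mul_transpose_eq_sum (E : Matrix κ ι ℝ) :
    (E * Eᵀ).trace = ∑ i, E i ⬝ᵥ E i := by
  simp [trace, mul_apply, dotProduct]

theorem trace_mul_transpose_nonneg (E : Matrix κ ι ℝ) : 0 ≤ (E * Eᵀ).trace := by
  rw [trace_mul_transpose_eq_sum]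
  exact Finset.sum_nonneg fun i _ => dotProduct_self_nonneg' _

theorem trace_conj_nonneg (E : Matrix κ ι ℝ) {S : Matrix ι ι ℝ} (hS : S.PosSemidef) :
    0 ≤ (E * S * Eᵀ).trace := by
  rw [trace_conj_eq_sum]
  exact Finset.sum_nonneg fun i _ => by simpa using hS.dotProduct_mulVec_nonneg (E i)

variable [DecidableEq ι]

theorem norm_transpose [DecidableEq κ] (Z : Matrix κ ι ℝ) : ‖Zᵀ‖ = ‖Z‖ := by
  rw [← conjTranspose_eq_transpose_of_trivial, l2_opNorm_conjTranspose]

theorem norm_mulVec_le (Z : Matrix κ ι ℝ) (v : ι → ℝ) :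
    ‖WithLp.toLp 2 (Z *ᵥ v)‖ ≤ ‖Z‖ * ‖WithLp.toLp 2 v‖ :=
  l2_opNorm_mulVec Z (WithLp.toLp 2 v)

theorem dotProduct_mulVec_le_norm (S : Matrix ι ι ℝ) (v : ι → ℝ) :
    v ⬝ᵥ S *ᵥ v ≤ ‖S‖ * (v ⬝ᵥ v) := by
  rw [dotProduct_eq_inner, ← euclidean_norm_sq]
  have h1 := real_inner_le_norm (WithLp.toLp 2 v) (WithLp.toLp 2 (S *ᵥ v))
  have h3 := mul_le_mul_of_nonneg_left (norm_mulVec_le S v) (norm_nonneg (WithLp.toLp 2 v))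
  linarith

theorem trace_conj_le_norm (E : Matrix κ ι ℝ) (S : Matrix ι ι ℝ) :
    (E * S * Eᵀ).trace ≤ ‖S‖ * (E * Eᵀ).trace := by
  rw [trace_conj_eq_sum, trace_mul_transpose_eq_sum, Finset.mul_sum]
  exact Finset.sum_le_sum fun i _ => dotProduct_mulVec_le_norm _ _

/-- The spectral norm is at most the Frobenius norm, by Cauchy–Schwarz on each row. -/
theorem norm_sq_le_trace (G : Matrix κ ι ℝ) : ‖G‖ ^ 2 ≤ (G * Gᵀ).trace := by
  have hn := trace_mul_transpose_nonneg G
  have key : ‖G‖ ≤ √((G * Gᵀ).trace) := by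
    rw [l2_opNorm_def]
    refine ContinuousLinearMap.opNorm_le_bound _ (Real.sqrt_nonneg _) fun x => ?_
    refine le_of_sq_le_sq ?_ (by positivity)
    rw [mul_pow, Real.sq_sqrt hn]
    change ‖WithLp.toLp 2 (G *ᵥ x.ofLp)‖ ^ 2 ≤ _
    rw [euclidean_norm_sq, trace_mul_transpose_eq_sum, Finset.sum_mul]
    refine Finset.sum_le_sum fun i _ => ?_
    have h := abs_real_inner_le_norm (WithLp.toLp 2 (G i)) x
    have h2 := pow_le_pow_left₀ (abs_nonneg _) h 2
    rw [sq_abs, mul_pow, euclidean_norm_sq] at h2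
    have h3 : (G *ᵥ x.ofLp) i = inner ℝ (WithLp.toLp 2 (G i)) x := by
      rw [mulVec, dotProduct_eq_inner]
    rw [h3, ← pow_two]
    exact h2
  calc ‖G‖ ^ 2 ≤ √((G * Gᵀ).trace) ^ 2 := pow_le_pow_left₀ (norm_nonneg _) key 2
    _ = _ := Real.sq_sqrt hn

theorem abs_apply_le_norm (Z : Matrix ι ι ℝ) (i : ι) : |Z i i| ≤ ‖Z‖ := by
  have h1 := abs_real_inner_le_norm (WithLp.toLp 2 (Pi.single i (1 : ℝ) : ι → ℝ))
    (WithLp.toLp 2 (Z *ᵥ Pi.single i 1))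
  have h2 := norm_mulVec_le Z (Pi.single i 1)
  have hn : ‖WithLp.toLp 2 (Pi.single i (1 : ℝ) : ι → ℝ)‖ = 1 := by
    simp
  rw [← dotProduct_eq_inner, hn, one_mul] at h1
  rw [hn, mul_one] at h2
  refine le_trans (le_of_eq ?_) (h1.trans h2)
  simp

theorem abs_trace_le (Z : Matrix ι ι ℝ) : |Z.trace| ≤ Fintype.card ι * ‖Z‖ := by
  refine (Finset.abs_sum_le_sum_abs _ _).trans ?_
  refine (Finset.sum_le_sum fun i _ => abs_apply_le_norm Z i).trans ?_
  simp

theorem norm_vecMulVec_le (v : κ → ℝ) (w : ι → ℝ) :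
    ‖vecMulVec v w‖ ≤ ‖WithLp.toLp 2 v‖ * ‖WithLp.toLp 2 w‖ := by
  refine le_of_sq_le_sq ((norm_sq_le_trace _).trans (le_of_eq ?_)) (by positivity)
  rw [mul_pow, euclidean_norm_sq, euclidean_norm_sq, trace_mul_transpose_eq_sum]
  simp only [dotProduct, vecMulVec_apply, Finset.sum_mul_sum]
  exact Finset.sum_congr rfl fun a _ => Finset.sum_congr rfl fun b _ => by ring

theorem sigmaMin_nonneg (Z : Matrix ι ι ℝ) : 0 ≤ sigmaMin Z :=
  LinearMap.singularValues_nonneg _ _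

/-- Expand `v` in an eigenbasis of the adjoint of Z composed with Z: the eigenvalues are the squared
singular values, and the last of them is the smallest. -/
theorem sigmaMin_sq_mul_le (Z : Matrix ι ι ℝ) (v : ι → ℝ) :
    sigmaMin Z ^ 2 * (v ⬝ᵥ v) ≤ (Z *ᵥ v) ⬝ᵥ (Z *ᵥ v) := by
  set L := Matrix.toEuclideanLin Z with hL
  have hfin : Module.finrank ℝ (EuclideanSpace ℝ ι) = Fintype.card ι := by simp
  have hsym := L.isSymmetric_adjoint_comp_self
  set b := hsym.eigenvectorBasis hfin
  set x : EuclideanSpace ℝ ι := WithLp.toLp 2 v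
  have h1 : (Z *ᵥ v) ⬝ᵥ (Z *ᵥ v) = inner ℝ x ((LinearMap.adjoint L ∘ₗ L) x) := by
    rw [LinearMap.comp_apply, LinearMap.adjoint_inner_right, dotProduct_eq_inner]
    rfl
  have h2 : inner ℝ x ((LinearMap.adjoint L ∘ₗ L) x)
      = ∑ i, hsym.eigenvalues hfin i * (inner ℝ (b i) x) ^ 2 := by
    rw [← b.sum_inner_mul_inner x]
    refine Finset.sum_congr rfl fun i _ => ?_
    have : inner ℝ (b i) ((LinearMap.adjoint L ∘ₗ L) x)
        = hsym.eigenvalues hfin i * inner ℝ (b i) x := by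
      rw [← hsym (b i) x, hsym.apply_eigenvectorBasis hfin i, inner_smul_left]
      simp [b]
    rw [this, real_inner_comm x]
    ring
  have h3 : v ⬝ᵥ v = ∑ i, (inner ℝ (b i) x) ^ 2 := by
    rw [dotProduct_eq_inner, ← b.sum_inner_mul_inner]
    refine Finset.sum_congr rfl fun i _ => ?_
    rw [real_inner_comm (WithLp.toLp 2 v)]
    ring
  rw [h1, h2, h3, Finset.mul_sum]
  refine Finset.sum_le_sum fun i _ => mul_le_mul_of_nonneg_right ?_ (sq_nonneg _)
  rw [← L.sq_singularValues_fin hfin i]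
  refine pow_le_pow_left₀ (sigmaMin_nonneg Z) (L.singularValues_antitone ?_) 2
  omega

/-- On a unit eigenvector, `sigmaMin_sq_mul_le` says that the eigenvalue λ of Z satisfies λ² ≥
σ_min²; since λ ≥ 0, λ ≥ σ_min, and so Z - σ_min I has no negative eigenvalue. -/
theorem sigmaMin_mul_le {Z : Matrix ι ι ℝ} (hZ : Z.PosSemidef) (v : ι → ℝ) :
    sigmaMin Z * (v ⬝ᵥ v) ≤ v ⬝ᵥ Z *ᵥ v := by
  have hH : (Z - sigmaMin Z • (1 : Matrix ι ι ℝ)).IsHermitian :=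
    hZ.isHermitian.sub (by simp [IsHermitian])
  have hpsd : (Z - sigmaMin Z • (1 : Matrix ι ι ℝ)).PosSemidef := by
    rw [hH.posSemidef_iff_eigenvalues_nonneg]
    intro i
    set u : ι → ℝ := (hH.eigenvectorBasis i).ofLp with hu
    have huu : u ⬝ᵥ u = 1 := by
      rw [← euclidean_norm_sq]
      have := hH.eigenvectorBasis.orthonormal.1 i
      simp [hu, this]
    have he : Z *ᵥ u = (hH.eigenvalues i + sigmaMin Z) • u := by
      have := hH.mulVec_eigenvectorBasis i
      rw [sub_mulVec, smul_mulVec, one_mulVec, sub_eq_iff_eq_add] at this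
      rw [this, add_smul]
    have hnn : 0 ≤ hH.eigenvalues i + sigmaMin Z := by
      have := hZ.dotProduct_mulVec_nonneg u
      simpa [he, huu] using this
    have hsq := sigmaMin_sq_mul_le Z u
    rw [he] at hsq
    simp only [smul_dotProduct, dotProduct_smul, huu, smul_eq_mul, mul_one] at hsq
    rw [← pow_two] at hsq
    have := le_of_sq_le_sq hsq hnn
    simpa using this
  have := hpsd.dotProduct_mulVec_nonneg v
  simp only [star_trivial, sub_mulVec, smul_mulVec, one_mulVec, dotProduct_sub, dotProduct_smul,
    smul_eq_mul] at this
  linarith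

theorem sigmaMin_pos [Nonempty ι] {Z : Matrix ι ι ℝ} (hZ : Z.PosDef) : 0 < sigmaMin Z := by
  have hinj : Function.Injective (Matrix.toEuclideanLin Z) := by
    rw [← LinearMap.ker_eq_bot, LinearMap.ker_eq_bot']
    intro x hx
    by_contra hne
    have hx0 : x.ofLp ≠ 0 := fun h => hne (by ext i; simp [h])
    have h := hZ.dotProduct_mulVec_pos hx0
    have h0 : Z *ᵥ x.ofLp = 0 := congrArg WithLp.ofLp hx
    simp [h0] at h
  refine (LinearMap.injective_iff_forall_lt_finrank_singularValues_pos _).1 hinj _ ?_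
  have := Fintype.card_pos (α := ι)
  simp only [finrank_euclideanSpace]
  omega

theorem sigmaMin_mul_trace_le {S : Matrix ι ι ℝ} (hS : S.PosSemidef) (E : Matrix κ ι ℝ) :
    sigmaMin S * (E * Eᵀ).trace ≤ (E * S * Eᵀ).trace := by
  rw [trace_conj_eq_sum, trace_mul_transpose_eq_sum, Finset.mul_sum]
  exact Finset.sum_le_sum fun i _ => sigmaMin_mul_le hS _

theorem sigmaMin_sq_mul_trace_le (S : Matrix ι ι ℝ) (hS : Sᵀ = S) (E : Matrix κ ι ℝ) :
    sigmaMin S ^ 2 * (E * Eᵀ).trace ≤ (E * S * (E * S)ᵀ).trace := by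
  rw [trace_mul_transpose_eq_sum, trace_mul_transpose_eq_sum, Finset.mul_sum]
  refine Finset.sum_le_sum fun i _ => (sigmaMin_sq_mul_le S (E i)).trans (le_of_eq ?_)
  have : (E * S) i = S *ᵥ E i := by
    rw [← vecMul_transpose, hS]; rfl
  rw [this]

end MatrixFacts

section TraceFacts

open scoped MatrixOrder

variable {ι : Type} [Fintype ι] [DecidableEq ι]

/-- With X = CᵀC, cyclicity turns the trace into that of C Y Cᵀ. -/
theorem trace_mul_nonneg {Y X : Matrix ι ι ℝ} (hY : Y.PosSemidef) (hX : X.PosSemidef) :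
    0 ≤ (Y * X).trace := by
  obtain ⟨C, rfl⟩ := CStarAlgebra.nonneg_iff_eq_star_mul_self.1 hX.nonneg
  rw [star_eq_conjTranspose, conjTranspose_eq_transpose_of_trivial, ← Matrix.mul_assoc,
    trace_mul_comm, ← Matrix.mul_assoc]
  exact trace_conj_nonneg C hY

theorem sigmaMin_mul_trace_le_trace_mul {Y X : Matrix ι ι ℝ} (hY : Y.PosSemidef)
    (hX : X.PosSemidef) : sigmaMin Y * X.trace ≤ (Y * X).trace := by
  obtain ⟨C, rfl⟩ := CStarAlgebra.nonneg_iff_eq_star_mul_self.1 hX.nonneg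
  rw [star_eq_conjTranspose, conjTranspose_eq_transpose_of_trivial, trace_mul_comm Cᵀ,
    ← Matrix.mul_assoc, trace_mul_comm (Y * Cᵀ), ← Matrix.mul_assoc]
  exact sigmaMin_mul_trace_le hY C

end TraceFacts

/-! ### The moment problem: value matrices, performance difference, gradient domination. -/

/-- The deterministic problem satisfied by the second moments of a linear-quadratic problem: they
evolve as `Σ_{t+1} = (F_t - B_t K_t) Σ_t (F_t - B_t K_t)ᵀ + N_t`, and the cost is linear in them. -/
structure MomentLQ (ι κ : Type) [Fintype ι] [DecidableEq ι] [Fintype κ] [DecidableEq κ]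
    (T : ℕ) where
  F : Fin T → Matrix ι ι ℝ
  B : Fin T → Matrix ι κ ℝ
  N : Fin T → Matrix ι ι ℝ
  Q : Fin (T + 1) → Matrix ι ι ℝ
  R : Fin T → Matrix κ κ ℝ
  S₀ : Matrix ι ι ℝ
  N_symm : ∀ t, (N t)ᵀ = N t
  Q_posSemidef : ∀ t, (Q t).PosSemidef
  R_posSemidef : ∀ t, (R t).PosSemidef
  S₀_symm : S₀ᵀ = S₀

namespace MomentLQ

variable {ι κ : Type} [Fintype ι] [DecidableEq ι] [Fintype κ] [DecidableEq κ] {T : ℕ}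
  (D : MomentLQ ι κ T) (K K' : Fin T → Matrix κ ι ℝ)

/-- The closed loop matrix. -/
def closed (t : Fin T) : Matrix ι ι ℝ := D.F t - D.B t * K t

/-- The second moments. -/
def moment (t : Fin (T + 1)) : Matrix ι ι ℝ :=
  Fin.induction (motive := fun _ => Matrix ι ι ℝ) D.S₀
    (fun s Z => D.closed K s * Z * (D.closed K s)ᵀ + D.N s) t

/-- The cost as a function of the gains. -/
def cost : ℝ :=
  (∑ t : Fin T, ((D.Q t.castSucc * D.moment K t.castSucc).trace
    + (D.R t * (K t * D.moment K t.castSucc * (K t)ᵀ)).trace))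
    + (D.Q (Fin.last T) * D.moment K (Fin.last T)).trace

/-- The matrices of the quadratic value functions. -/
def value (t : Fin (T + 1)) : Matrix ι ι ℝ :=
  Fin.reverseInduction (motive := fun _ => Matrix ι ι ℝ) (D.Q (Fin.last T))
    (fun s P => D.Q s.castSucc + (K s)ᵀ * D.R s * K s + (D.closed K s)ᵀ * P * D.closed K s) t

/-- The Hessian of the one-step problem in the control. -/
def hess (t : Fin T) : Matrix κ κ ℝ := D.R t + (D.B t)ᵀ * D.value K t.succ * D.B t

/-- The one-step optimality residual of the gain. -/
def residual (t : Fin T) : Matrix κ ι ℝ :=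
  D.R t * K t - (D.B t)ᵀ * D.value K t.succ * D.closed K t

/-- The gradient of the cost. -/
def gradient (t : Fin T) : Matrix κ ι ℝ := (2 : ℝ) • (D.residual K t * D.moment K t.castSucc)

theorem moment_zero : D.moment K 0 = D.S₀ := rfl

theorem moment_succ (t : Fin T) : D.moment K t.succ =
    D.closed K t * D.moment K t.castSucc * (D.closed K t)ᵀ + D.N t := by
  simp [moment, Fin.induction_succ]

theorem value_last : D.value K (Fin.last T) = D.Q (Fin.last T) := by
  simp [value]

theorem value_castSucc (t : Fin T) : D.value K t.castSucc =
    D.Q t.castSucc + (K t)ᵀ * D.R t * K t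
      + (D.closed K t)ᵀ * D.value K t.succ * D.closed K t := by
  simp [value]

theorem moment_transpose (t : Fin (T + 1)) : (D.moment K t)ᵀ = D.moment K t := by
  induction t using Fin.induction with
  | zero => exact D.S₀_symm
  | succ t ih => simp [moment_succ, transpose_mul, ih, D.N_symm, Matrix.mul_assoc]

theorem value_posSemidef (t : Fin (T + 1)) : (D.value K t).PosSemidef := by
  induction t using Fin.reverseInduction with
  | last => rw [value_last]; exact D.Q_posSemidef _
  | cast t ih =>
    rw [value_castSucc]
    refine ((D.Q_posSemidef _).add ?_).add ?_
    · simpa using (D.R_posSemidef t).conjTranspose_mul_mul_same (K t)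
    · simpa using ih.conjTranspose_mul_mul_same (D.closed K t)

theorem value_transpose (t : Fin (T + 1)) : (D.value K t)ᵀ = D.value K t := by
  simpa using (D.value_posSemidef K t).isHermitian.eq

theorem R_transpose (t : Fin T) : (D.R t)ᵀ = D.R t := by
  simpa using (D.R_posSemidef t).isHermitian.eq

/-- Causality: a gain influences only later moments. -/
theorem moment_congr {K K' : Fin T → Matrix κ ι ℝ} (s : Fin (T + 1))
    (h : ∀ t : Fin T, t.castSucc < s → K t = K' t) : D.moment K s = D.moment K' s := by
  induction s using Fin.induction with
  | zero => rfl
  | succ t ih =>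
    rw [moment_succ, moment_succ, ih fun r hr => h r (hr.trans Fin.castSucc_lt_succ), closed,
      closed, h t Fin.castSucc_lt_succ]

theorem quadratic_expansion (t : Fin T) :
    (K' t)ᵀ * D.R t * K' t + (D.closed K' t)ᵀ * D.value K t.succ * D.closed K' t
      = (K t)ᵀ * D.R t * K t + (D.closed K t)ᵀ * D.value K t.succ * D.closed K t
        + ((K' t - K t)ᵀ * D.residual K t + (D.residual K t)ᵀ * (K' t - K t)
          + (K' t - K t)ᵀ * D.hess K t * (K' t - K t)) := by
  obtain ⟨Δ, hΔ⟩ : ∃ Δ, K' t = K t + Δ := ⟨K' t - K t, by abel⟩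
  have hc : D.closed K' t = D.closed K t - D.B t * Δ := by
    rw [closed, closed, hΔ, Matrix.mul_add]; abel
  rw [hc, hΔ, add_sub_cancel_left, residual, hess]
  simp only [Matrix.mul_add, Matrix.add_mul, Matrix.mul_sub, Matrix.sub_mul, transpose_add,
    transpose_sub, transpose_mul, Matrix.mul_assoc, R_transpose, value_transpose,
    transpose_transpose]
  abel

/-- One-step form of the performance difference. -/
theorem step_difference (t : Fin T) :
    (D.Q t.castSucc * D.moment K' t.castSucc).trace
        + (D.R t * (K' t * D.moment K' t.castSucc * (K' t)ᵀ)).trace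
        + (D.value K t.succ * D.moment K' t.succ).trace
      = (D.value K t.castSucc * D.moment K' t.castSucc).trace
        + (D.value K t.succ * D.N t).trace
        + (2 * (D.residual K t * D.moment K' t.castSucc * (K' t - K t)ᵀ).trace
          + (D.hess K t * ((K' t - K t) * D.moment K' t.castSucc * (K' t - K t)ᵀ)).trace) := by
  set Z := D.moment K' t.castSucc with hZ
  have hZt : Zᵀ = Z := D.moment_transpose K' _
  have cyc : ∀ {α : Type} [Fintype α] (Y : Matrix α α ℝ) (X : Matrix α ι ℝ),
      (Y * (X * Z * Xᵀ)).trace = (Xᵀ * Y * X * Z).trace := by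
    intro α _ Y X
    rw [← Matrix.mul_assoc, trace_mul_comm]
    simp only [Matrix.mul_assoc]
  have h1 : (D.residual K t * Z * (K' t - K t)ᵀ).trace
      = ((K' t - K t)ᵀ * D.residual K t * Z).trace := by
    rw [trace_mul_comm, Matrix.mul_assoc]
  have h2 : ((D.residual K t)ᵀ * (K' t - K t) * Z).trace
      = ((K' t - K t)ᵀ * D.residual K t * Z).trace := by
    rw [← trace_transpose, transpose_mul, hZt, transpose_mul, transpose_transpose,
      trace_mul_comm]
  -- The quadratic expansion of the value recursion, paired with the moment under `K'`; the two
  -- cross terms agree after transposition because that moment is symmetric.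
  have h3 := congrArg (fun Y => (Y * Z).trace) (D.quadratic_expansion K K' t)
  simp only [Matrix.add_mul, trace_add, h2] at h3
  rw [moment_succ, ← hZ, Matrix.mul_add, trace_add, cyc, cyc, cyc, h1, value_castSucc]
  simp only [Matrix.add_mul, trace_add]
  linarith

/-- Summing the one-step identity telescopes the terms tr(P_t Σ'_t), where P is the value under `K`.
What remains besides the residual terms does not depend on `K'`, and the residual terms vanish for
`K' = K`. -/
theorem performance_difference :
    D.cost K' - D.cost K = ∑ t : Fin T,
      (2 * (D.residual K t * D.moment K' t.castSucc * (K' t - K t)ᵀ).trace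
        + (D.hess K t * ((K' t - K t) * D.moment K' t.castSucc * (K' t - K t)ᵀ)).trace) := by
  have key : ∀ K' : Fin T → Matrix κ ι ℝ, D.cost K' = (D.value K 0 * D.S₀).trace
      + ∑ t : Fin T, (D.value K t.succ * D.N t).trace + ∑ t : Fin T,
      (2 * (D.residual K t * D.moment K' t.castSucc * (K' t - K t)ᵀ).trace
        + (D.hess K t * ((K' t - K t) * D.moment K' t.castSucc * (K' t - K t)ᵀ)).trace) := by
    intro K'
    have h1 := Fin.sum_univ_succ fun t => (D.value K t * D.moment K' t).trace
    rw [Fin.sum_univ_castSucc] at h1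
    have h2 := Finset.sum_congr (s₁ := Finset.univ) rfl fun t _ => D.step_difference K K' t
    simp only [Finset.sum_add_distrib, moment_zero, value_last] at h1 h2 ⊢
    simp only [cost, Finset.sum_add_distrib]
    linarith
  rw [key K', key K]
  simp

theorem hess_trace_ge (t : Fin T) {X : Matrix κ κ ℝ} (hX : X.PosSemidef) :
    sigmaMin (D.R t) * X.trace ≤ (D.hess K t * X).trace := by
  rw [hess, Matrix.add_mul, trace_add]
  have h1 := sigmaMin_mul_trace_le_trace_mul (D.R_posSemidef t) hX
  have h2 : ((D.B t)ᵀ * D.value K t.succ * D.B t).PosSemidef := by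
    simpa using (D.value_posSemidef K t.succ).conjTranspose_mul_mul_same (D.B t)
  linarith [trace_mul_nonneg h2 hX]

omit [DecidableEq ι] [DecidableEq κ] in
theorem conj_posSemidef (Y : Matrix κ ι ℝ) {X : Matrix ι ι ℝ} (hX : X.PosSemidef) :
    (Y * X * Yᵀ).PosSemidef := by
  simpa using hX.mul_mul_conjTranspose_same Y

/-- Gradient domination: the optimality gap is controlled by the squared gradient. -/
theorem cost_sub_le_gradient {σX σR : ℝ} (hX : 0 < σX) (hR : 0 < σR)
    (hσR : ∀ t, σR ≤ sigmaMin (D.R t)) (hσX : ∀ t, σX ≤ sigmaMin (D.moment K t))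
    (hpsd : ∀ t, (D.moment K' t).PosSemidef) :
    4 * σX ^ 2 * σR * (D.cost K - D.cost K') ≤
      ‖∑ t, D.moment K' t‖ * ∑ t, (D.gradient K t * (D.gradient K t)ᵀ).trace := by
  have step : ∀ t : Fin T, -(4 * σX ^ 2 * σR * (2 * (D.residual K t * D.moment K' t.castSucc *
      (K' t - K t)ᵀ).trace + (D.hess K t * ((K' t - K t) * D.moment K' t.castSucc *
        (K' t - K t)ᵀ)).trace))
      ≤ ‖∑ t, D.moment K' t‖ * (D.gradient K t * (D.gradient K t)ᵀ).trace := by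
    intro t
    set Z := D.moment K' t.castSucc with hZ
    set Δ := K' t - K t
    set E := D.residual K t
    have hZp : Z.PosSemidef := hpsd _
    have hΔ := conj_posSemidef Δ hZp
    have h1 : σR * (Δ * Z * Δᵀ).trace ≤ (D.hess K t * (Δ * Z * Δᵀ)).trace :=
      (mul_le_mul_of_nonneg_right (hσR t) (trace_conj_nonneg Δ hZp)).trans (D.hess_trace_ge K t hΔ)
    -- Completing the square: with H bounded below by σ_R, the step's contribution is at least -tr(E
    -- Z Eᵀ) / σ_R.
    have h2 := trace_conj_nonneg (σR • Δ + E) hZp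
    have hc : (Δ * Z * Eᵀ).trace = (E * Z * Δᵀ).trace := by
      rw [← trace_transpose]
      simp [transpose_mul, Z, moment_transpose, Matrix.mul_assoc]
    simp only [Matrix.add_mul, Matrix.mul_add, transpose_add, transpose_smul, Matrix.smul_mul,
      Matrix.mul_smul, trace_add, trace_smul, smul_eq_mul, hc] at h2
    have h3 : (E * Z * Eᵀ).trace ≤ ‖∑ t, D.moment K' t‖ * (E * Eᵀ).trace := by
      refine le_trans ?_ (trace_conj_le_norm E _)
      have hdiff : ((∑ t, D.moment K' t) - Z).PosSemidef := by
        rw [← Finset.sum_erase_eq_sub (Finset.mem_univ _)]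
        exact posSemidef_sum _ fun s _ => hpsd s
      have := trace_conj_nonneg E hdiff
      rw [Matrix.mul_sub, Matrix.sub_mul, trace_sub] at this
      linarith
    -- The gradient is twice the residual times the moment, so the nondegenerate moment can be
    -- divided out.
    have h4 : 4 * σX ^ 2 * (E * Eᵀ).trace ≤ (D.gradient K t * (D.gradient K t)ᵀ).trace := by
      have h5 := sigmaMin_sq_mul_trace_le (D.moment K t.castSucc) (D.moment_transpose K _) E
      have h6 : σX ^ 2 ≤ sigmaMin (D.moment K t.castSucc) ^ 2 :=
        pow_le_pow_left₀ hX.le (hσX _) 2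
      have h7 := mul_le_mul_of_nonneg_right h6 (trace_mul_transpose_nonneg E)
      simp only [gradient, transpose_smul, Matrix.smul_mul, Matrix.mul_smul, trace_smul,
        smul_eq_mul]
      linarith
    have h8 := mul_le_mul_of_nonneg_left h4 (norm_nonneg (∑ t, D.moment K' t))
    have h9 : -(σR * (2 * (E * Z * Δᵀ).trace + (D.hess K t * (Δ * Z * Δᵀ)).trace))
        ≤ (E * Z * Eᵀ).trace := by
      have := mul_le_mul_of_nonneg_left h1 hR.le
      nlinarith
    have h10 := mul_le_mul_of_nonneg_left (h9.trans h3) (by positivity : 0 ≤ 4 * σX ^ 2)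
    linarith
  have h := D.performance_difference K K'
  rw [Finset.mul_sum]
  refine le_trans (le_of_eq ?_) (Finset.sum_le_sum fun t _ => step t)
  rw [Finset.sum_neg_distrib, ← Finset.mul_sum, ← h]
  ring

/-- Changing only the gain at time `t` leaves the moment at time `t` unchanged, so the performance
difference makes the cost exactly quadratic along this line. The partial derivatives are read off
from the linear coefficient. -/
theorem cost_add_single (t : Fin T) (E : Matrix κ ι ℝ) (s : ℝ) :
    D.cost (K + s • (Pi.single t E : Fin T → Matrix κ ι ℝ)) = D.cost K + s * (D.gradient K t * Eᵀ).trace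
      + s ^ 2 * (D.hess K t * (E * D.moment K t.castSucc * Eᵀ)).trace := by
  have h := D.performance_difference K (K + s • (Pi.single t E : Fin T → Matrix κ ι ℝ))
  rw [Finset.sum_eq_single t] at h
  · have hm : D.moment (K + s • (Pi.single t E : Fin T → Matrix κ ι ℝ)) t.castSucc = D.moment K t.castSucc := by
      refine D.moment_congr _ fun r hr => ?_
      have : r ≠ t := fun h => absurd hr (by simp [h])
      simp [Pi.single_eq_of_ne this]
    have hΔ : (K + s • (Pi.single t E : Fin T → Matrix κ ι ℝ)) t - K t = s • E := by simp
    rw [hm, hΔ] at h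
    simp only [transpose_smul, Matrix.smul_mul, Matrix.mul_smul, trace_smul, smul_eq_mul] at h
    simp only [gradient, Matrix.smul_mul, trace_smul, smul_eq_mul]
    linarith
  · intro r _ hr
    simp [Pi.single_eq_of_ne hr]
  · simp

theorem lineDeriv_cost (t : Fin T) (i : κ) (j : ι) :
    lineDeriv ℝ D.cost K (Pi.single t (Matrix.single i j 1)) = D.gradient K t i j := by
  have htr : (D.gradient K t * (Matrix.single i j (1 : ℝ))ᵀ).trace = D.gradient K t i j := by
    simp [transpose_single, trace_mul_single]
  rw [lineDeriv]
  simp only [cost_add_single, htr]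
  generalize D.gradient K t i j = a
  generalize (D.hess K t * (Matrix.single i j (1 : ℝ) * D.moment K t.castSucc
    * (Matrix.single i j (1 : ℝ))ᵀ)).trace = b
  have h : HasDerivAt (fun s : ℝ => D.cost K + s * a + s ^ 2 * b)
      (1 * a + (2 * (0 : ℝ) ^ 1 * 1) * b) 0 :=
    (((hasDerivAt_id (0 : ℝ)).mul_const a).const_add (D.cost K)).add
      (((hasDerivAt_id (0 : ℝ)).pow 2).mul_const b)
  rw [h.deriv]
  ring

theorem continuous_cost : Continuous D.cost := by
  have hm : ∀ t, Continuous fun K => D.moment K t := by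
    intro t
    induction t using Fin.induction with
    | zero => exact continuous_const
    | succ t ih =>
      simp only [moment_succ, closed]
      fun_prop
  unfold cost
  fun_prop

end MomentLQ

/-! ### Bounds by powers of one constant, and local smoothness of the cost. -/

section PowerBounds

variable {α β γ : Type} [Fintype α] [Fintype β] [Fintype γ] [DecidableEq α] [DecidableEq β]
  [DecidableEq γ] {θ : ℝ} {a b c : ℕ}

omit [DecidableEq α] in
theorem norm_mul_le_of_le {X : Matrix α β ℝ} {Y : Matrix β γ ℝ} {x y : ℝ} (hX : ‖X‖ ≤ x)
    (hY : ‖Y‖ ≤ y) : ‖X * Y‖ ≤ x * y :=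
  (l2_opNorm_mul X Y).trans
    (mul_le_mul hX hY (norm_nonneg _) ((norm_nonneg _).trans hX))

omit [DecidableEq α] in
theorem norm_mul_le_pow {X : Matrix α β ℝ} {Y : Matrix β γ ℝ} (hX : ‖X‖ ≤ θ ^ a)
    (hY : ‖Y‖ ≤ θ ^ b) : ‖X * Y‖ ≤ θ ^ (a + b) := by
  rw [pow_add]
  exact norm_mul_le_of_le hX hY

/-- A sum costs one extra power of θ and a product adds exponents, so numerical constants are
absorbed and only exponents need tracking. -/
theorem add_le_pow_succ (hθ : 3 ≤ θ) {x y : ℝ} (hx : x ≤ θ ^ a) (hy : y ≤ θ ^ b) (ha : a ≤ c)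
    (hb : b ≤ c) : x + y ≤ θ ^ (c + 1) := by
  have h1 : θ ^ a ≤ θ ^ c := pow_le_pow_right₀ (by linarith) ha
  have h2 : θ ^ b ≤ θ ^ c := pow_le_pow_right₀ (by linarith) hb
  have h3 : 0 < θ ^ c := by positivity
  rw [pow_succ]
  nlinarith

omit [DecidableEq α] in
theorem norm_add_le_pow (hθ : 3 ≤ θ) {X Y : Matrix α β ℝ} (hX : ‖X‖ ≤ θ ^ a) (hY : ‖Y‖ ≤ θ ^ b)
    (ha : a ≤ c) (hb : b ≤ c) : ‖X + Y‖ ≤ θ ^ (c + 1) :=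
  (norm_add_le X Y).trans (add_le_pow_succ hθ hX hY ha hb)

omit [DecidableEq α] in
theorem norm_sub_le_pow (hθ : 3 ≤ θ) {X Y : Matrix α β ℝ} (hX : ‖X‖ ≤ θ ^ a) (hY : ‖Y‖ ≤ θ ^ b)
    (ha : a ≤ c) (hb : b ≤ c) : ‖X - Y‖ ≤ θ ^ (c + 1) :=
  (norm_sub_le X Y).trans (add_le_pow_succ hθ hX hY ha hb)

theorem norm_transpose_le {X : Matrix α β ℝ} {x : ℝ} (hX : ‖X‖ ≤ x) : ‖Xᵀ‖ ≤ x := by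
  rwa [norm_transpose]

end PowerBounds

namespace MomentLQ

variable {ι κ : Type} [Fintype ι] [DecidableEq ι] [Fintype κ] [DecidableEq κ] {T : ℕ}
  {D : MomentLQ ι κ T} {K K' : Fin T → Matrix κ ι ℝ} {θ : ℝ}

/-- All problem data are bounded by powers of `θ`. -/
structure IsBoundedBy (D : MomentLQ ι κ T) (θ : ℝ) : Prop where
  three_le : 3 ≤ θ
  horizon_le : (T : ℝ) ≤ θ
  card_le : (Fintype.card κ : ℝ) ≤ θ
  -- The exponents 3 and 5 allow for the noise mean: F is Â plus a product of two bounded factors,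
  -- and N is D̂(W - μμᵀ)D̂ᵀ with W the second moment and μ the mean of the noise.
  F_le : ∀ t, ‖D.F t‖ ≤ θ ^ 3
  B_le : ∀ t, ‖D.B t‖ ≤ θ ^ 1
  N_le : ∀ t, ‖D.N t‖ ≤ θ ^ 5
  Q_le : ∀ t, ‖D.Q t‖ ≤ θ ^ 1
  R_le : ∀ t, ‖D.R t‖ ≤ θ ^ 1
  S₀_le : ‖D.S₀‖ ≤ θ ^ 1

namespace IsBoundedBy

variable (h : D.IsBoundedBy θ) (hK : ∀ t, ‖K t‖ ≤ θ ^ 2) (hK' : ∀ t, ‖K' t‖ ≤ θ ^ 2)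
include h

theorem one_le : 1 ≤ θ := by linarith [h.three_le]

theorem pos : 0 < θ := by linarith [h.three_le]

include hK

theorem norm_closed_le (t : Fin T) : ‖D.closed K t‖ ≤ θ ^ 4 :=
  norm_sub_le_pow h.three_le (h.F_le t) (norm_mul_le_pow (h.B_le t) (hK t)) le_rfl (by norm_num)

theorem norm_moment_le_aux (t : Fin (T + 1)) : ‖D.moment K t‖ ≤ θ ^ (1 + 9 * (t : ℕ)) := by
  induction t using Fin.induction with
  | zero => simpa [moment_zero] using h.S₀_le
  | succ t ih =>
    have hc := h.norm_closed_le hK t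
    rw [moment_succ]
    have := norm_add_le_pow (c := 9 * (t : ℕ) + 9) h.three_le
      (norm_mul_le_pow (norm_mul_le_pow hc ih) (norm_transpose_le hc)) (h.N_le t)
      (by simp; omega) (by omega)
    refine this.trans (le_of_eq ?_)
    congr 1
    simp
    ring

theorem norm_moment_le (t : Fin (T + 1)) : ‖D.moment K t‖ ≤ θ ^ (9 * T + 1) :=
  (h.norm_moment_le_aux hK t).trans (pow_le_pow_right₀ h.one_le (by omega))

/-- The weight encodes growth by at most θ^9 per backward step: θ^8 from the two closed loop factors
and one θ for a sum of three terms. -/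
theorem norm_value_mul_le (t : Fin (T + 1)) :
    ‖D.value K t‖ * θ ^ (9 * (t : ℕ)) ≤ θ ^ (9 * T + 1) := by
  have hpos := h.pos
  induction t using Fin.reverseInduction with
  | last =>
    rw [value_last, Fin.val_last, pow_succ']
    exact mul_le_mul_of_nonneg_right (by simpa using h.Q_le (Fin.last T)) (by positivity)
  | cast t ih =>
    have hc := h.norm_closed_le hK t
    rw [value_castSucc, Fin.val_castSucc]
    set P := D.value K t.succ
    have h1 : ‖(K t)ᵀ * D.R t * K t‖ ≤ θ ^ 5 :=
      norm_mul_le_pow (norm_mul_le_pow (norm_transpose_le (hK t)) (h.R_le t)) (hK t)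
    have h2 : ‖(D.closed K t)ᵀ * P * D.closed K t‖ ≤ θ ^ 4 * ‖P‖ * θ ^ 4 :=
      norm_mul_le_of_le (norm_mul_le_of_le (norm_transpose_le hc) le_rfl) hc
    have h3 := (norm_add_le (D.Q t.castSucc + (K t)ᵀ * D.R t * K t)
      ((D.closed K t)ᵀ * P * D.closed K t)).trans
      (add_le_add ((norm_add_le _ _).trans (add_le_add (h.Q_le t.castSucc) h1)) h2)
    have ht : 9 * (t : ℕ) + 5 ≤ 9 * T := by omega
    have h5 : θ ^ (9 * (t : ℕ) + 5) ≤ θ ^ (9 * T) := pow_le_pow_right₀ h.one_le ht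
    have h1' : θ ^ (9 * (t : ℕ) + 1) ≤ θ ^ (9 * T) := pow_le_pow_right₀ h.one_le (by omega)
    have h6 : ‖P‖ * θ ^ (9 * (t : ℕ) + 8) ≤ θ ^ (9 * T) := by
      refine le_of_mul_le_mul_right ?_ hpos
      calc ‖P‖ * θ ^ (9 * (t : ℕ) + 8) * θ = ‖P‖ * θ ^ (9 * ((t.succ : Fin (T + 1)) : ℕ)) := by
            rw [mul_assoc, ← pow_succ]; congr 2
        _ ≤ θ ^ (9 * T) * θ := by rw [← pow_succ]; exact ih
    calc _ ≤ (θ ^ 1 + θ ^ 5 + θ ^ 4 * ‖P‖ * θ ^ 4) * θ ^ (9 * (t : ℕ)) :=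
          mul_le_mul_of_nonneg_right h3 (by positivity)
      _ = θ ^ (9 * (t : ℕ) + 1) + θ ^ (9 * (t : ℕ) + 5) + ‖P‖ * θ ^ (9 * (t : ℕ) + 8) := by ring
      _ ≤ 3 * θ ^ (9 * T) := by linarith
      _ ≤ θ ^ (9 * T + 1) := by
        rw [pow_succ']
        exact mul_le_mul_of_nonneg_right h.three_le (by positivity)

theorem norm_value_le (t : Fin (T + 1)) : ‖D.value K t‖ ≤ θ ^ (9 * T + 1) :=
  (le_mul_of_one_le_right (norm_nonneg _) (one_le_pow₀ h.one_le)).trans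
    (h.norm_value_mul_le hK t)

theorem norm_hess_le (t : Fin T) : ‖D.hess K t‖ ≤ θ ^ (9 * T + 4) :=
  norm_add_le_pow h.three_le (h.R_le t) (norm_mul_le_pow
    (norm_mul_le_pow (norm_transpose_le (h.B_le t)) (h.norm_value_le hK _)) (h.B_le t))
    (by omega) (by omega)

theorem norm_residual_le (t : Fin T) : ‖D.residual K t‖ ≤ θ ^ (9 * T + 7) :=
  norm_sub_le_pow h.three_le (norm_mul_le_pow (h.R_le t) (hK t)) (norm_mul_le_pow
    (norm_mul_le_pow (norm_transpose_le (h.B_le t)) (h.norm_value_le hK _))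
    (h.norm_closed_le hK t)) (by omega) (by omega)

theorem norm_gradient_le (t : Fin T) : ‖D.gradient K t‖ ≤ θ ^ (18 * T + 9) := by
  rw [gradient, norm_smul, Real.norm_ofNat]
  have h1 := norm_mul_le_pow (h.norm_residual_le hK t) (h.norm_moment_le hK t.castSucc)
  calc 2 * ‖D.residual K t * D.moment K t.castSucc‖ ≤ θ * θ ^ (9 * T + 7 + (9 * T + 1)) :=
        mul_le_mul (by linarith [h.three_le]) h1 (norm_nonneg _) h.pos.le
    _ = θ ^ (18 * T + 9) := by ring

include hK'

theorem norm_moment_sub_le_aux {δ : ℝ} (hδ : ∀ t, ‖K' t - K t‖ ≤ δ) (hδ0 : 0 ≤ δ)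
    (t : Fin (T + 1)) :
    ‖D.moment K' t - D.moment K t‖ ≤ θ ^ (9 * T + 7 + 9 * (t : ℕ)) * δ := by
  have hpos := h.pos
  induction t using Fin.induction with
  | zero =>
    simp only [moment_zero, sub_self, norm_zero]
    positivity
  | succ t ih =>
    set M := D.closed K t with hM
    set M' := D.closed K' t with hM'
    set Z := D.moment K t.castSucc
    set Z' := D.moment K' t.castSucc
    have hMM : M' - M = -(D.B t * (K' t - K t)) := by
      rw [hM, hM', closed, closed, Matrix.mul_sub]; abel
    have hMb : ‖M‖ ≤ θ ^ 4 := h.norm_closed_le hK t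
    have hMb' : ‖M'‖ ≤ θ ^ 4 := h.norm_closed_le hK' t
    have hd : ‖M' - M‖ ≤ θ ^ 1 * δ := by
      rw [hMM, norm_neg]
      exact norm_mul_le_of_le (h.B_le t) (hδ t)
    have hZ : ‖Z‖ ≤ θ ^ (9 * T + 1) := h.norm_moment_le hK _
    -- Telescoping one factor at a time: the first term propagates the earlier error, the other two
    -- are of first order in the change of the gain.
    have key : D.moment K' t.succ - D.moment K t.succ
        = M' * (Z' - Z) * M'ᵀ + (M' - M) * Z * M'ᵀ + M * Z * (M' - M)ᵀ := by
      rw [moment_succ, moment_succ]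
      simp only [Matrix.mul_sub, Matrix.sub_mul, transpose_sub]
      abel
    have h1 : ‖M' * (Z' - Z) * M'ᵀ‖ ≤ θ ^ 4 * (θ ^ (9 * T + 7 + 9 * (t : ℕ)) * δ) * θ ^ 4 :=
      norm_mul_le_of_le (norm_mul_le_of_le hMb' ih) (norm_transpose_le hMb')
    have h2 : ‖(M' - M) * Z * M'ᵀ‖ ≤ θ ^ 1 * δ * θ ^ (9 * T + 1) * θ ^ 4 :=
      norm_mul_le_of_le (norm_mul_le_of_le hd hZ) (norm_transpose_le hMb')
    have h3 : ‖M * Z * (M' - M)ᵀ‖ ≤ θ ^ 4 * θ ^ (9 * T + 1) * (θ ^ 1 * δ) :=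
      norm_mul_le_of_le (norm_mul_le_of_le hMb hZ) (norm_transpose_le hd)
    have h4 : θ ^ (9 * T + 6) ≤ θ ^ (9 * T + 15 + 9 * (t : ℕ)) :=
      pow_le_pow_right₀ h.one_le (by omega)
    have h5 := mul_le_mul_of_nonneg_right h4 hδ0
    rw [key]
    calc _ ≤ _ := (norm_add_le _ _).trans (add_le_add ((norm_add_le _ _).trans
            (add_le_add h1 h2)) h3)
      _ = θ ^ (9 * T + 15 + 9 * (t : ℕ)) * δ + 2 * (θ ^ (9 * T + 6) * δ) := by ring
      _ ≤ 3 * (θ ^ (9 * T + 15 + 9 * (t : ℕ)) * δ) := by linarith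
      _ ≤ θ * (θ ^ (9 * T + 15 + 9 * (t : ℕ)) * δ) :=
        mul_le_mul_of_nonneg_right h.three_le (by positivity)
      _ = θ ^ (9 * T + 7 + 9 * ((t.succ : Fin (T + 1)) : ℕ)) * δ := by
        rw [Fin.val_succ]; ring

theorem norm_moment_sub_le {δ : ℝ} (hδ : ∀ t, ‖K' t - K t‖ ≤ δ) (hδ0 : 0 ≤ δ)
    (t : Fin (T + 1)) : ‖D.moment K' t - D.moment K t‖ ≤ θ ^ (18 * T + 7) * δ :=
  (h.norm_moment_sub_le_aux hK hK' hδ hδ0 t).trans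
    (mul_le_mul_of_nonneg_right (pow_le_pow_right₀ h.one_le (by omega)) hδ0)

/-- The cost is smooth on bounded sets of gains. -/
theorem cost_sub_le {δ : ℝ} (hδ : ∀ t, ‖K' t - K t‖ ≤ δ) (hδ0 : 0 ≤ δ) :
    D.cost K' - D.cost K ≤ ∑ t, (D.gradient K t * (K' t - K t)ᵀ).trace
      + θ ^ (27 * T + 18) * δ ^ 2 := by
  have hpos := h.pos
  have step : ∀ t : Fin T,
      2 * (D.residual K t * D.moment K' t.castSucc * (K' t - K t)ᵀ).trace
        + (D.hess K t * ((K' t - K t) * D.moment K' t.castSucc * (K' t - K t)ᵀ)).trace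
      ≤ (D.gradient K t * (K' t - K t)ᵀ).trace + θ ^ (27 * T + 17) * δ ^ 2 := by
    intro t
    set Δ := K' t - K t
    set E := D.residual K t
    set Z := D.moment K t.castSucc with hZ
    set Z' := D.moment K' t.castSucc
    have hΔ : ‖Δᵀ‖ ≤ δ := norm_transpose_le (hδ t)
    -- Exchanging the moment under `K'` for the one under `K` produces the gradient; the error is of
    -- second order because the moments are Lipschitz in the gains.
    have e1 : 2 * (E * Z' * Δᵀ).trace
        = (D.gradient K t * Δᵀ).trace + 2 * (E * (Z' - Z) * Δᵀ).trace := by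
      rw [gradient, ← hZ, Matrix.mul_sub, Matrix.sub_mul, trace_sub, Matrix.smul_mul, trace_smul,
        smul_eq_mul]
      ring
    have b1 : (E * (Z' - Z) * Δᵀ).trace
        ≤ θ * (θ ^ (9 * T + 7) * (θ ^ (18 * T + 7) * δ) * δ) :=
      (le_abs_self _).trans ((abs_trace_le _).trans (mul_le_mul h.card_le
        (norm_mul_le_of_le (norm_mul_le_of_le (h.norm_residual_le hK t)
          (h.norm_moment_sub_le hK hK' hδ hδ0 _)) hΔ) (norm_nonneg _) hpos.le))
    have b2 : (D.hess K t * (Δ * Z' * Δᵀ)).trace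
        ≤ θ * (θ ^ (9 * T + 4) * (δ * θ ^ (9 * T + 1) * δ)) :=
      (le_abs_self _).trans ((abs_trace_le _).trans (mul_le_mul h.card_le
        (norm_mul_le_of_le (h.norm_hess_le hK t) (norm_mul_le_of_le (norm_mul_le_of_le (hδ t)
          (h.norm_moment_le hK' _)) hΔ)) (norm_nonneg _) hpos.le))
    have h4 : θ ^ (18 * T + 6) ≤ θ ^ (27 * T + 15) := pow_le_pow_right₀ h.one_le (by omega)
    have h5 := mul_le_mul_of_nonneg_right h4 (sq_nonneg δ)
    have h6 : 3 * (θ ^ (27 * T + 15) * δ ^ 2) ≤ θ ^ (27 * T + 17) * δ ^ 2 := by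
      have : 3 ≤ θ ^ 2 := by nlinarith [h.three_le]
      calc _ ≤ θ ^ 2 * (θ ^ (27 * T + 15) * δ ^ 2) :=
            mul_le_mul_of_nonneg_right this (by positivity)
        _ = _ := by ring
    have b1' : (E * (Z' - Z) * Δᵀ).trace ≤ θ ^ (27 * T + 15) * δ ^ 2 := b1.trans (le_of_eq (by ring))
    have b2' : (D.hess K t * (Δ * Z' * Δᵀ)).trace ≤ θ ^ (18 * T + 6) * δ ^ 2 :=
      b2.trans (le_of_eq (by ring))
    rw [e1]
    linarith
  rw [D.performance_difference K K']
  refine (Finset.sum_le_sum fun t _ => step t).trans ?_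
  rw [Finset.sum_add_distrib, Finset.sum_const, Finset.card_univ, Fintype.card_fin, nsmul_eq_mul]
  have := mul_le_mul_of_nonneg_right h.horizon_le
    (by positivity : 0 ≤ θ ^ (27 * T + 17) * δ ^ 2)
  have e : θ * (θ ^ (27 * T + 17) * δ ^ 2) = θ ^ (27 * T + 18) * δ ^ 2 := by ring
  linarith

omit hK hK' in
/-- A gradient step with a small stepsize decreases the cost. -/
theorem cost_gradient_step_le (hKθ : ∀ t, ‖K t‖ ≤ θ) {η : ℝ} (hη : 0 ≤ η)
    (hηθ : η * θ ^ (27 * T + 19) ≤ 1) :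
    D.cost (fun t => K t - η • D.gradient K t) - D.cost K
      ≤ -(η / 2) * ∑ t, (D.gradient K t * (D.gradient K t)ᵀ).trace := by
  have hpos := h.pos
  have hK2 : ∀ t, ‖K t‖ ≤ θ ^ 2 := fun t => (hKθ t).trans (by nlinarith [h.one_le])
  set g := ∑ t, (D.gradient K t * (D.gradient K t)ᵀ).trace with hg
  have hg0 : 0 ≤ g := Finset.sum_nonneg fun t _ => trace_mul_transpose_nonneg _
  have hgt : ∀ t, ‖D.gradient K t‖ ≤ √g := fun t => Real.le_sqrt_of_sq_le
    ((norm_sq_le_trace _).trans (Finset.single_le_sum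
      (f := fun t => (D.gradient K t * (D.gradient K t)ᵀ).trace)
      (fun t _ => trace_mul_transpose_nonneg _) (Finset.mem_univ t)))
  have hdiff : ∀ t, (fun t => K t - η • D.gradient K t) t - K t = -(η • D.gradient K t) :=
    fun t => by simp
  have hηpow : ∀ a ≤ 27 * T + 19, η * θ ^ a ≤ 1 := fun a ha =>
    (mul_le_mul_of_nonneg_left (pow_le_pow_right₀ h.one_le ha) hη).trans hηθ
  have hK' : ∀ t, ‖(fun t => K t - η • D.gradient K t) t‖ ≤ θ ^ 2 := by
    intro t
    -- The step has length at most 1, so the new gain is bounded by θ + 1 ≤ θ². This is why the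
    -- estimates above assume θ² and not θ.
    have h1 : ‖η • D.gradient K t‖ ≤ 1 := by
      rw [norm_smul, Real.norm_of_nonneg hη]
      exact (mul_le_mul_of_nonneg_left (h.norm_gradient_le hK2 t) hη).trans
        (hηpow _ (by omega))
    have h2 := norm_sub_le (K t) (η • D.gradient K t)
    have := hKθ t
    simp only
    nlinarith [h.three_le]
  have main := h.cost_sub_le (δ := η * √g) hK2 hK' (fun t => by
    rw [hdiff, norm_neg, norm_smul, Real.norm_of_nonneg hη]
    exact mul_le_mul_of_nonneg_left (hgt t) hη) (by positivity)
  refine main.trans ?_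
  simp only [hdiff, transpose_neg, transpose_smul, Matrix.mul_neg, Matrix.mul_smul, trace_neg,
    trace_smul, smul_eq_mul, Finset.sum_neg_distrib, ← Finset.mul_sum]
  rw [← hg, mul_pow, Real.sq_sqrt hg0]
  -- The last power of θ in the stepsize condition makes the second-order term at most half of the
  -- first-order decrease.
  have h1 : η * θ ^ (27 * T + 18) ≤ 1 / 2 := by
    have : η * θ ^ (27 * T + 18) * θ ≤ 1 := by rw [mul_assoc, ← pow_succ]; exact hηθ
    have h0 : 0 ≤ η * θ ^ (27 * T + 18) := by positivity
    nlinarith [h.three_le]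
  have h2 := mul_le_mul_of_nonneg_right h1 (mul_nonneg hη hg0)
  linarith

end IsBoundedBy

end MomentLQ

/-! ### Convergence of the iteration for the moment problem. -/

/-- Geometric decay of a nonnegative sequence, in terms of the number of steps needed to reach a
given accuracy. -/
theorem le_of_geometric_decay {g : ℕ → ℝ} {a ε : ℝ} (hg : ∀ i, 0 ≤ g i) (ha : 0 < a)
    (hdec : ∀ i, g (i + 1) ≤ (1 - a) * g i) (hε : 0 < ε) {N : ℕ}
    (hN : a⁻¹ * Real.log (g 0 / ε) ≤ N) : g N ≤ ε := by
  have hexp : ∀ i : ℕ, g i ≤ Real.exp (-(a * i)) * g 0 := by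
    intro i
    induction i with
    | zero => simp
    | succ i ih =>
      -- Passing to the exponential before iterating needs only `g i ≥ 0` and no sign of `1 - a`.
      have h1 : 1 - a ≤ Real.exp (-a) := Real.one_sub_le_exp_neg a
      calc g (i + 1) ≤ (1 - a) * g i := hdec i
        _ ≤ Real.exp (-a) * g i := mul_le_mul_of_nonneg_right h1 (hg i)
        _ ≤ Real.exp (-a) * (Real.exp (-(a * i)) * g 0) :=
          mul_le_mul_of_nonneg_left ih (Real.exp_pos _).le
        _ = _ := by rw [← mul_assoc, ← Real.exp_add]; push_cast; ring_nf
  -- For `g 0 = 0` the logarithm takes its default value 0 and `hN` carries no information, but then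
  -- the sequence is already at most 0.
  rcases (hg 0).eq_or_lt with h0 | h0
  · have := hexp N
    rw [← h0, mul_zero] at this
    linarith
  · have h1 : Real.log (g 0 / ε) ≤ a * N := by
      rwa [inv_mul_le_iff₀ ha] at hN
    rw [Real.log_le_iff_le_exp (by positivity), div_le_iff₀ hε] at h1
    have h2 := mul_le_mul_of_nonneg_left h1 (Real.exp_pos (-(a * N))).le
    rw [← mul_assoc, ← Real.exp_add, neg_add_cancel, Real.exp_zero, one_mul] at h2
    exact (hexp N).trans h2

namespace MomentLQ

variable {ι κ : Type} [Fintype ι] [DecidableEq ι] [Fintype κ] [DecidableEq κ] {T : ℕ}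
  {D : MomentLQ ι κ T} {K₀ : Fin T → Matrix κ ι ℝ} {θ σX σR η : ℝ}

/-- The hypotheses under which policy gradient with stepsize `η`, started at `K₀`, converges. -/
structure StepCondition (D : MomentLQ ι κ T) (K₀ : Fin T → Matrix κ ι ℝ) (θ σX σR η : ℝ) :
    Prop where
  bounded : D.IsBoundedBy θ
  -- Required separately because `N` is only symmetric in `MomentLQ`; it comes from the moments
  -- being second moments of random vectors.
  moment_posSemidef : ∀ K t, (D.moment K t).PosSemidef
  sigX_pos : 0 < σX
  sigR_pos : 0 < σR
  sigX_le : ∀ K, D.cost K ≤ D.cost K₀ → ∀ t, σX ≤ sigmaMin (D.moment K t)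
  sigR_le : ∀ t, σR ≤ sigmaMin (D.R t)
  cost_le : D.cost K₀ ≤ θ * (σX * σR)
  step_pos : 0 < η
  step_mul_le : η * θ ^ (27 * T + 19) ≤ 1

theorem trace_control_le_cost (hpsd : ∀ K t, (D.moment K t).PosSemidef) (K : Fin T → Matrix κ ι ℝ)
    (t : Fin T) : (D.R t * (K t * D.moment K t.castSucc * (K t)ᵀ)).trace ≤ D.cost K := by
  have hQ : ∀ t, 0 ≤ (D.Q t * D.moment K t).trace := fun t =>
    trace_mul_nonneg (D.Q_posSemidef t) (hpsd K t)
  have hR : ∀ t : Fin T, 0 ≤ (D.R t * (K t * D.moment K t.castSucc * (K t)ᵀ)).trace := fun t =>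
    trace_mul_nonneg (D.R_posSemidef t) (conj_posSemidef (K t) (hpsd K _))
  have h1 := Finset.single_le_sum (f := fun t : Fin T => (D.Q t.castSucc *
    D.moment K t.castSucc).trace + (D.R t * (K t * D.moment K t.castSucc * (K t)ᵀ)).trace)
    (fun t _ => add_nonneg (hQ _) (hR t)) (Finset.mem_univ t)
  have h2 := hQ t.castSucc
  have h3 := hQ (Fin.last T)
  unfold cost
  linarith

namespace StepCondition

variable (h : D.StepCondition K₀ θ σX σR η)
include h

/-- The expected control cost at time `t` gives σ_X σ_R ‖K_t‖² ≤ C(K) ≤ C(K₀) ≤ θ σ_X σ_R. -/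
theorem norm_le {K : Fin T → Matrix κ ι ℝ} (hK : D.cost K ≤ D.cost K₀) (t : Fin T) :
    ‖K t‖ ≤ θ := by
  have hθ := h.bounded.one_le
  have h1 := trace_control_le_cost h.moment_posSemidef K t
  have hp := h.moment_posSemidef K t.castSucc
  have h2 := sigmaMin_mul_trace_le_trace_mul (D.R_posSemidef t) (conj_posSemidef (K t) hp)
  have h3 := sigmaMin_mul_trace_le hp (K t)
  have h4 := mul_le_mul_of_nonneg_right (h.sigX_le K hK t.castSucc)
    (trace_mul_transpose_nonneg (K t))
  have h5 := mul_le_mul_of_nonneg_right (h.sigR_le t) (trace_conj_nonneg (K t) hp)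
  have h6 := mul_le_mul_of_nonneg_left (norm_sq_le_trace (K t)) h.sigX_pos.le
  have h7 := mul_le_mul_of_nonneg_left (h6.trans (h4.trans h3)) h.sigR_pos.le
  have hσ : 0 < σX * σR := mul_pos h.sigX_pos h.sigR_pos
  have h8 : (σX * σR) * ‖K t‖ ^ 2 ≤ (σX * σR) * θ := by
    linarith [h.cost_le]
  have h9 : ‖K t‖ ^ 2 ≤ θ ^ 2 := (le_of_mul_le_mul_left h8 hσ).trans (by nlinarith)
  exact le_of_sq_le_sq h9 (by linarith)

theorem step_le {K : Fin T → Matrix κ ι ℝ} (hK : D.cost K ≤ D.cost K₀) :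
    D.cost (fun t => K t - η • D.gradient K t) - D.cost K
      ≤ -(η / 2) * ∑ t, (D.gradient K t * (D.gradient K t)ᵀ).trace :=
  h.bounded.cost_gradient_step_le (h.norm_le hK) h.step_pos.le h.step_mul_le

theorem step_cost_le {K : Fin T → Matrix κ ι ℝ} (hK : D.cost K ≤ D.cost K₀) :
    D.cost (fun t => K t - η • D.gradient K t) ≤ D.cost K₀ := by
  have h1 := h.step_le hK
  have h2 : 0 ≤ ∑ t, (D.gradient K t * (D.gradient K t)ᵀ).trace :=
    Finset.sum_nonneg fun t _ => trace_mul_transpose_nonneg _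
  have := mul_nonneg (half_pos h.step_pos).le h2
  linarith

theorem contraction {K K' : Fin T → Matrix κ ι ℝ} (hK : D.cost K ≤ D.cost K₀) :
    D.cost (fun t => K t - η • D.gradient K t) - D.cost K' ≤
      (1 - 2 * η * (σX ^ 2 * σR / (‖∑ t, D.moment K' t‖ + 1))) * (D.cost K - D.cost K') := by
  have h1 := h.step_le hK
  have h2 := D.cost_sub_le_gradient K K' h.sigX_pos h.sigR_pos h.sigR_le (h.sigX_le K hK)
    (h.moment_posSemidef K')
  set g := ∑ t, (D.gradient K t * (D.gradient K t)ᵀ).trace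
  have hg : 0 ≤ g := Finset.sum_nonneg fun t _ => trace_mul_transpose_nonneg _
  have hS := norm_nonneg (∑ t, D.moment K' t)
  set s := ‖∑ t, D.moment K' t‖
  -- Enlarging `s` to `s + 1` uses only `g ≥ 0`, so `K'` may be any gain here.
  have h3 : 4 * (σX ^ 2 * σR / (s + 1)) * (D.cost K - D.cost K') ≤ g := by
    rw [mul_div_assoc', div_mul_eq_mul_div, div_le_iff₀ (by positivity)]
    linarith
  have h4 := mul_le_mul_of_nonneg_left h3 (half_pos h.step_pos).le
  linarith

theorem exists_optimal : ∃ K, ∀ K', D.cost K ≤ D.cost K' := by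
  have hcl : IsClosed {K | D.cost K ≤ D.cost K₀} := isClosed_le D.continuous_cost continuous_const
  have hsub : {K | D.cost K ≤ D.cost K₀} ⊆ Metric.closedBall 0 θ := by
    intro K hK
    rw [mem_closedBall_zero_iff, pi_norm_le_iff_of_nonneg h.bounded.pos.le]
    exact h.norm_le hK
  have : ProperSpace (Fin T → Matrix κ ι ℝ) := FiniteDimensional.proper_real _
  have hcomp : IsCompact {K | D.cost K ≤ D.cost K₀} :=
    (isCompact_closedBall (0 : Fin T → Matrix κ ι ℝ) θ).of_isClosed_subset hcl hsub
  obtain ⟨K, hK, hmin⟩ := hcomp.exists_isMinOn ⟨K₀, le_refl (D.cost K₀)⟩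
    D.continuous_cost.continuousOn
  refine ⟨K, fun K' => ?_⟩
  by_cases hK' : D.cost K' ≤ D.cost K₀
  · exact hmin hK'
  · exact le_trans hK (not_le.1 hK').le

end StepCondition

end MomentLQ

/-! ### Second moments of random vectors. -/

section CrossMoment

variable {Ω : Type} [MeasurableSpace Ω] {P : Measure Ω} {α β γ : Type} [Fintype α] [Fintype β]
  [Fintype γ]

/-- The matrix `E[U Vᵀ]` of two random vectors. -/
def crossMoment (P : Measure Ω) (U : Ω → α → ℝ) (V : Ω → β → ℝ) : Matrix α β ℝ :=
  Matrix.of fun i j => ∫ ω, U ω i * V ω j ∂P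

/-- Square integrability of all coordinates of a random vector. -/
def SquareIntegrable (P : Measure Ω) (U : Ω → α → ℝ) : Prop := ∀ i, MemLp (fun ω => U ω i) 2 P

omit [Fintype α] in
theorem SquareIntegrable.mulVec {U : Ω → β → ℝ} (hU : SquareIntegrable P U) (Z : Matrix α β ℝ) :
    SquareIntegrable P fun ω => Z *ᵥ U ω := by
  intro i
  simp only [Matrix.mulVec, dotProduct]
  exact memLp_finsetSum _ fun j _ => (hU j).const_mul (Z i j)

omit [Fintype α] in
theorem SquareIntegrable.add {U V : Ω → α → ℝ} (hU : SquareIntegrable P U)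
    (hV : SquareIntegrable P V) : SquareIntegrable P fun ω => U ω + V ω :=
  fun i => (hU i).add (hV i)

omit [Fintype α] [Fintype β] in
theorem SquareIntegrable.integrable_mul {U : Ω → α → ℝ} {V : Ω → β → ℝ}
    (hU : SquareIntegrable P U) (hV : SquareIntegrable P V) (i : α) (j : β) :
    Integrable (fun ω => U ω i * V ω j) P :=
  (hU i).integrable_mul (hV j)

omit [Fintype α] [Fintype β] in
theorem transpose_crossMoment (U : Ω → α → ℝ) (V : Ω → β → ℝ) :
    (crossMoment P U V)ᵀ = crossMoment P V U := by
  ext i j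
  simp [crossMoment, mul_comm]

omit [Fintype α] [Fintype γ] in
theorem crossMoment_mulVec_left {U : Ω → β → ℝ} {V : Ω → γ → ℝ} (hU : SquareIntegrable P U)
    (hV : SquareIntegrable P V) (Z : Matrix α β ℝ) :
    crossMoment P (fun ω => Z *ᵥ U ω) V = Z * crossMoment P U V := by
  ext i j
  simp only [crossMoment, of_apply, mul_apply, Matrix.mulVec, dotProduct, Finset.sum_mul, mul_assoc]
  rw [integral_finsetSum _ fun l _ => (hU.integrable_mul hV l j).const_mul _]
  simp only [integral_const_mul]

omit [Fintype α] [Fintype γ] in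
theorem crossMoment_mulVec_right {U : Ω → β → ℝ} {V : Ω → γ → ℝ} (hU : SquareIntegrable P U)
    (hV : SquareIntegrable P V) (Z : Matrix α β ℝ) :
    crossMoment P V (fun ω => Z *ᵥ U ω) = crossMoment P V U * Zᵀ := by
  rw [← transpose_crossMoment, crossMoment_mulVec_left hU hV, transpose_mul,
    transpose_crossMoment]

omit [Fintype α] in
theorem crossMoment_add_add {U V : Ω → α → ℝ} (hU : SquareIntegrable P U)
    (hV : SquareIntegrable P V) :
    crossMoment P (fun ω => U ω + V ω) (fun ω => U ω + V ω) =
      crossMoment P U U + crossMoment P U V + crossMoment P V U + crossMoment P V V := by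
  ext i j
  simp only [crossMoment, of_apply, Matrix.add_apply, Pi.add_apply]
  rw [← integral_add (hU.integrable_mul hU i j) (hU.integrable_mul hV i j),
    ← integral_add _ (hV.integrable_mul hU i j), ← integral_add _ (hV.integrable_mul hV i j)]
  · congr 1; ext ω; ring
  · exact ((hU.integrable_mul hU i j).add (hU.integrable_mul hV i j)).add
      (hV.integrable_mul hU i j)
  · exact (hU.integrable_mul hU i j).add (hU.integrable_mul hV i j)

theorem SquareIntegrable.integrable_quadratic {U : Ω → α → ℝ} (hU : SquareIntegrable P U)
    (Y : Matrix α α ℝ) : Integrable (fun ω => U ω ⬝ᵥ Y *ᵥ U ω) P := by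
  simp only [dotProduct]
  exact integrable_finsetSum _ fun i _ => hU.integrable_mul (hU.mulVec Y) i i

theorem integral_quadratic {U : Ω → α → ℝ} (hU : SquareIntegrable P U) (Y : Matrix α α ℝ) :
    ∫ ω, U ω ⬝ᵥ Y *ᵥ U ω ∂P = (Y * crossMoment P U U).trace := by
  rw [← crossMoment_mulVec_left hU hU]
  simp only [dotProduct, crossMoment, trace, diag_apply, of_apply]
  rw [integral_finsetSum _ fun i _ => hU.integrable_mul (hU.mulVec Y) i i]
  simp only [mul_comm]

theorem crossMoment_posSemidef {U : Ω → α → ℝ} (hU : SquareIntegrable P U) :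
    (crossMoment P U U).PosSemidef := by
  refine PosSemidef.of_dotProduct_mulVec_nonneg ?_ fun v => ?_
  · rw [IsHermitian, conjTranspose_eq_transpose_of_trivial, transpose_crossMoment]
  -- Choosing the quadratic form vvᵀ identifies vᵀ E[UUᵀ] v with E[(v·U)²].
  · have h := integral_quadratic hU (vecMulVec v v)
    rw [vecMulVec_mul, trace_vecMulVec, dotProduct_comm, ← dotProduct_mulVec] at h
    rw [star_trivial, dotProduct_comm, dotProduct_comm, ← h]
    refine integral_nonneg fun ω => ?_
    have : U ω ⬝ᵥ vecMulVec v v *ᵥ U ω = (v ⬝ᵥ U ω) * (v ⬝ᵥ U ω) := by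
      rw [vecMulVec_mulVec]
      simp [dotProduct_comm (U ω)]
    simp only [this]
    exact mul_self_nonneg _

end CrossMoment

/-! ### Trajectories, integrability, and independence of state and noise. -/

section Trajectory

variable {m n k T : ℕ} (S : LQSystem m n k T) (K : Gain m n T)

theorem traj_zero (ω : Path m k T) : traj S K ω 0 = augState ω.1 := rfl

theorem traj_succ (ω : Path m k T) (t : Fin T) : traj S K ω t.succ =
    (augA S t - augB S t * K t) *ᵥ traj S K ω t.castSucc + augD S t *ᵥ ω.2 t := by
  rw [traj, Fin.induction_succ, sub_mulVec, ← mulVec_mulVec, control, mulVec_neg,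
    ← sub_eq_add_neg]
  rfl

theorem traj_inr (ω : Path m k T) (t : Fin (T + 1)) (u : Unit) : traj S K ω t (Sum.inr u) = 1 := by
  induction t using Fin.induction with
  | zero => rfl
  | succ t ih =>
    rw [traj_succ]
    have h1 : ∀ v, (augD S t *ᵥ v) (Sum.inr u) = 0 := by
      intro v; simp [augD, Matrix.mulVec, dotProduct]
    have h2 : ∀ v, ((augB S t * K t) *ᵥ v) (Sum.inr u) = 0 := by
      intro v; rw [← mulVec_mulVec]; simp [augB, Matrix.mulVec, dotProduct]
    have h3 : ∀ v, (augA S t *ᵥ v) (Sum.inr u) = v (Sum.inr u) := by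
      intro v; simp [augA, Matrix.mulVec, dotProduct]
    rw [Pi.add_apply, sub_mulVec, Pi.sub_apply, h1, h2, h3, ih]
    simp

theorem traj_congr {ω ω' : Path m k T} (t : Fin (T + 1)) (h0 : ω.1 = ω'.1)
    (h : ∀ s : Fin T, s.castSucc < t → ω.2 s = ω'.2 s) : traj S K ω t = traj S K ω' t := by
  induction t using Fin.induction with
  | zero => rw [traj_zero, traj_zero, h0]
  | succ t ih =>
    rw [traj_succ, traj_succ, ih fun s hs => h s (hs.trans Fin.castSucc_lt_succ),
      h t Fin.castSucc_lt_succ]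

theorem continuous_traj (t : Fin (T + 1)) : Continuous fun ω => traj S K ω t := by
  induction t using Fin.induction with
  | zero =>
    simp only [traj_zero]
    refine continuous_pi fun i => ?_
    rcases i with i | i
    · exact (continuous_apply i).comp continuous_fst
    · exact continuous_const
  | succ t ih =>
    simp only [traj_succ]
    fun_prop

theorem dotProduct_augQ_mulVec (t : Fin (T + 1)) (x : Aug m → ℝ) :
    x ⬝ᵥ augQ S t *ᵥ x = (x ∘ Sum.inl) ⬝ᵥ S.Q t *ᵥ (x ∘ Sum.inl) := by
  simp [augQ, fromBlocks_mulVec, dotProduct]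

theorem augQ_posSemidef (t : Fin (T + 1)) : (augQ S t).PosSemidef := by
  refine PosSemidef.of_dotProduct_mulVec_nonneg ?_ fun v => ?_
  · exact IsHermitian.fromBlocks (S.Q_posDef t).isHermitian (by simp) (by simp)
  · rw [star_trivial, dotProduct_augQ_mulVec]
    simpa using (S.Q_posDef t).posSemidef.dotProduct_mulVec_nonneg (v ∘ Sum.inl)

theorem initial_cost_le_pathCost (ω : Path m k T) :
    ω.1 ⬝ᵥ S.Q 0 *ᵥ ω.1 ≤ pathCost S K ω := by
  have hQ : ∀ t, 0 ≤ traj S K ω t ⬝ᵥ augQ S t *ᵥ traj S K ω t := fun t => by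
    simpa using (augQ_posSemidef S t).dotProduct_mulVec_nonneg (traj S K ω t)
  have hR : ∀ t (u : Fin n → ℝ), 0 ≤ u ⬝ᵥ S.R t *ᵥ u := fun t u => by
    simpa using (S.R_posDef t).posSemidef.dotProduct_mulVec_nonneg u
  have h0 : ω.1 ⬝ᵥ S.Q 0 *ᵥ ω.1 = traj S K ω 0 ⬝ᵥ augQ S 0 *ᵥ traj S K ω 0 := by
    rw [dotProduct_augQ_mulVec]; rfl
  have h1 : traj S K ω 0 ⬝ᵥ augQ S 0 *ᵥ traj S K ω 0
      ≤ ∑ t, traj S K ω t ⬝ᵥ augQ S t *ᵥ traj S K ω t :=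
    Finset.single_le_sum (f := fun t => traj S K ω t ⬝ᵥ augQ S t *ᵥ traj S K ω t)
      (fun t _ => hQ t) (Finset.mem_univ 0)
  have h2 : 0 ≤ ∑ t : Fin T, control K t (traj S K ω t.castSucc) ⬝ᵥ S.R t *ᵥ
      control K t (traj S K ω t.castSucc) := Finset.sum_nonneg fun t _ => hR t _
  rw [Fin.sum_univ_castSucc] at h1
  rw [h0, pathCost, Finset.sum_add_distrib]
  linarith

end Trajectory

section Moments

variable {m n k T : ℕ} (S : LQSystem m n k T) (ν : Fin T → Measure (Fin k → ℝ)) (K : Gain m n T)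

theorem measurePreserving_snd_pathLaw [∀ t, IsProbabilityMeasure (ν t)] (t : Fin T) :
    MeasurePreserving (fun ω : Path m k T => ω.2 t) (pathLaw S ν) (ν t) :=
  have := S.init_prob
  (measurePreserving_eval ν t).comp measurePreserving_snd

theorem isProbabilityMeasure_pathLaw [∀ t, IsProbabilityMeasure (ν t)] :
    IsProbabilityMeasure (pathLaw S ν) :=
  have := S.init_prob
  inferInstanceAs (IsProbabilityMeasure (S.init.prod (Measure.pi ν)))

/-- Square integrability of the initial state and of the noises. -/
structure FiniteMoments : Prop where
  prob : ∀ t, IsProbabilityMeasure (ν t)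
  init : SquareIntegrable (pathLaw S ν) fun ω : Path m k T => ω.1
  noise : ∀ t j, MemLp (fun w : Fin k → ℝ => w j) 2 (ν t)

variable {S ν}

/-- All cost terms are nonnegative and Q_0 is positive definite, so a finite cost already bounds
E|x_0|². -/
theorem FiniteCost.finiteMoments {K : Gain m n T} (h : FiniteCost S ν K)
    (hp : ∀ t, IsProbabilityMeasure (ν t))
    (hν : ∀ t j, MemLp (fun w : Fin k → ℝ => w j) 2 (ν t)) : FiniteMoments S ν := by
  refine ⟨hp, fun i => ?_, hν⟩
  have : Nonempty (Fin m) := ⟨i⟩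
  have hm : Measurable fun ω : Path m k T => ω.1 i := by fun_prop
  rw [memLp_two_iff_integrable_sq hm.aestronglyMeasurable]
  have hσ := sigmaMin_pos (S.Q_posDef 0)
  refine (Integrable.const_mul h (sigmaMin (S.Q 0))⁻¹).mono' (by fun_prop)
    (Filter.Eventually.of_forall fun ω => ?_)
  rw [Real.norm_of_nonneg (sq_nonneg _), inv_mul_eq_div, le_div_iff₀ hσ, mul_comm]
  have h1 : (ω.1 i) ^ 2 ≤ ω.1 ⬝ᵥ ω.1 := by
    rw [pow_two]
    exact Finset.single_le_sum (f := fun j => ω.1 j * ω.1 j) (fun j _ => mul_self_nonneg _)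
      (Finset.mem_univ i)
  exact (mul_le_mul_of_nonneg_left h1 hσ.le).trans
    ((sigmaMin_mul_le (S.Q_posDef 0).posSemidef _).trans (initial_cost_le_pathCost S K ω))

namespace FiniteMoments

variable (h : FiniteMoments S ν)
include h

theorem noise_squareIntegrable (t : Fin T) :
    SquareIntegrable (pathLaw S ν) fun ω : Path m k T => ω.2 t := fun j =>
  have := h.prob
  (h.noise t j).comp_measurePreserving (measurePreserving_snd_pathLaw S ν t)

theorem traj_squareIntegrable (t : Fin (T + 1)) :
    SquareIntegrable (pathLaw S ν) fun ω => traj S K ω t := by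
  have := h.prob
  have := isProbabilityMeasure_pathLaw S ν
  induction t using Fin.induction with
  | zero =>
    rintro (i | u)
    · exact h.init i
    · exact memLp_const 1
  | succ t ih =>
    simp only [traj_succ]
    exact (ih.mulVec _).add ((h.noise_squareIntegrable t).mulVec _)

/-- The state at time `t` depends on x_0 and on noises before `t`, hence is independent of w_t.
Independence is applied for each fixed x_0 and then integrated by Fubini. -/
theorem crossMoment_traj_noise (t : Fin T) :
    crossMoment (pathLaw S ν) (fun ω => traj S K ω t.castSucc) (fun ω => ω.2 t) =
      vecMulVec (fun i => ∫ ω, traj S K ω t.castSucc i ∂(pathLaw S ν))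
        (fun j => ∫ w, w j ∂(ν t)) := by
  have := h.prob
  have := S.init_prob
  have := isProbabilityMeasure_pathLaw S ν
  ext i j
  have hX := h.traj_squareIntegrable K t.castSucc
  have hcoord : ∀ {I : Type} (a : I), Measurable fun v : I → Fin k → ℝ => v a j := by
    intro I a
    exact Measurable.comp (g := fun w : Fin k → ℝ => w j) (measurable_pi_apply j)
      (measurable_pi_apply a)
  have hindep : ∀ x : Fin m → ℝ, ProbabilityTheory.IndepFun
      (fun w : Fin T → Fin k → ℝ => traj S K (x, w) t.castSucc i)
      (fun w : Fin T → Fin k → ℝ => w t j) (Measure.pi ν) := by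
    intro x
    have hi : ProbabilityTheory.iIndepFun (fun s (w : Fin T → Fin k → ℝ) => w s)
        (Measure.pi ν) :=
      ProbabilityTheory.iIndepFun_pi (X := fun s (w : Fin k → ℝ) => w) fun s => by fun_prop
    have hf := hi.indepFun_finset (Finset.univ.filter (· < t)) {t} (by simp)
      fun s => measurable_pi_apply s
    -- Padding the past noises by zeros writes the state at time `t` as a measurable function of the
    -- coordinates before `t` alone.
    let extend : ((s : (Finset.univ.filter (· < t) : Finset (Fin T))) → Fin k → ℝ) →
        Fin T → Fin k → ℝ := fun v s => if hs : s < t then v ⟨s, by simpa using hs⟩ else 0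
    have hext : Measurable extend := by
      refine measurable_pi_lambda _ fun s => ?_
      by_cases hs : s < t
      · simp only [extend, hs, dite_true]
        exact measurable_pi_apply _
      · simp only [extend, hs, dite_false]
        exact measurable_const
    have h1 := hf.comp (φ := fun v => traj S K (x, extend v) t.castSucc i)
      (ψ := fun v => v ⟨t, by simp⟩ j)
      ((measurable_pi_apply i).comp ((continuous_traj S K t.castSucc).measurable.comp
        (measurable_const.prodMk hext)))
      (hcoord _)
    convert h1 using 1
    · ext w
      simp only [Function.comp]
      refine congrFun (traj_congr S K (ω := (x, w)) (ω' := (x, extend fun i => w i)) _ rfl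
        fun s hs => ?_) i
      have hs' : s < t := by simpa using hs
      simp [extend, hs']
    · rfl
  have hint := hX.integrable_mul (h.noise_squareIntegrable t) i j
  have hint1 : Integrable (fun ω => traj S K ω t.castSucc i) (pathLaw S ν) :=
    (hX i).integrable (by norm_num)
  simp only [crossMoment, of_apply, vecMulVec_apply]
  simp only [pathLaw] at hint hint1 ⊢
  rw [integral_prod _ hint, integral_prod _ hint1, ← integral_mul_const]
  congr 1
  ext x
  rw [(hindep x).integral_fun_mul_eq_mul_integral]
  · congr 1
    exact integral_comp_eval (μ := ν) (i := t) (f := fun w : Fin k → ℝ => w j)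
      (measurable_pi_apply j).aestronglyMeasurable
  · exact ((continuous_apply i).comp ((continuous_traj S K t.castSucc).comp
      (by fun_prop))).aestronglyMeasurable
  · exact (hcoord t).aestronglyMeasurable

end FiniteMoments

end Moments

/-! ### Reduction of the stochastic problem to the moment problem. -/

section MomentProblem

variable {m n k T : ℕ} {S : LQSystem m n k T} {ν : Fin T → Measure (Fin k → ℝ)}

/-- The coordinate vector of the constant coordinate of the augmented state. -/
def unitVec (m : ℕ) : Aug m → ℝ := Pi.single (Sum.inr ()) 1

theorem noiseMoment_transpose (ν : Fin T → Measure (Fin k → ℝ)) (t : Fin T) :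
    (noiseMoment ν t)ᵀ = noiseMoment ν t := by
  ext i j
  simp [noiseMoment, mul_comm]

variable (S ν) in
/-- The moment dynamics of a linear-quadratic problem. The mean of the noise is moved into the
system matrix, where it acts on the constant coordinate. -/
def momentLQ : MomentLQ (Aug m) (Fin n) T where
  F t := augA S t + vecMulVec (augD S t *ᵥ (noiseMean ν t).ofLp) (unitVec m)
  B := augB S
  N t := augD S t * (noiseMoment ν t - vecMulVec (noiseMean ν t).ofLp (noiseMean ν t).ofLp)
    * (augD S t)ᵀ
  Q := augQ S
  R := S.R
  S₀ := secondMoment S ν 0 0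
  N_symm t := by
    simp [transpose_mul, noiseMoment_transpose, transpose_vecMulVec, Matrix.mul_assoc]
  Q_posSemidef := augQ_posSemidef S
  R_posSemidef t := (S.R_posDef t).posSemidef
  S₀_symm := transpose_crossMoment _ _

/-- Since the last coordinate is 1, the mean of the state is a column of its second moment. This
keeps the recursion closed for noise with nonzero mean. -/
theorem integral_traj (K : Gain m n T) (t : Fin (T + 1)) :
    (fun i => ∫ ω, traj S K ω t i ∂(pathLaw S ν)) = secondMoment S ν K t *ᵥ unitVec m := by
  ext i
  simp [unitVec, secondMoment, traj_inr]

theorem cost_nonneg (K : Gain m n T) : 0 ≤ cost S ν K := by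
  refine integral_nonneg fun ω => ?_
  have h0 := initial_cost_le_pathCost S K ω
  have h1 : 0 ≤ ω.1 ⬝ᵥ S.Q 0 *ᵥ ω.1 := by
    simpa using (S.Q_posDef 0).posSemidef.dotProduct_mulVec_nonneg ω.1
  exact h1.trans h0

namespace FiniteMoments

variable (h : FiniteMoments S ν) (K : Gain m n T)
include h

theorem crossMoment_noise (t : Fin T) :
    crossMoment (pathLaw S ν) (fun ω : Path m k T => ω.2 t) (fun ω => ω.2 t)
      = noiseMoment ν t := by
  have := h.prob
  ext i j
  simp only [crossMoment, noiseMoment, of_apply]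
  have hmp := measurePreserving_snd_pathLaw S ν t
  conv_rhs => rw [← hmp.map_eq]
  rw [integral_map hmp.measurable.aemeasurable (by fun_prop)]

theorem secondMoment_unitVec_dotProduct (t : Fin (T + 1)) :
    (secondMoment S ν K t *ᵥ unitVec m) ⬝ᵥ unitVec m = 1 := by
  have := h.prob
  have := isProbabilityMeasure_pathLaw S ν
  simp [unitVec, secondMoment, traj_inr]

/-- Moving the mean μ into the closed loop matrix adds D̂μeᵀ, with e the constant direction. Its
cross terms are those of state and noise; its square adds D̂μμᵀD̂ᵀ because eᵀΣe = 1, and N subtracts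
this again. -/
theorem secondMoment_succ (t : Fin T) : secondMoment S ν K t.succ =
    (momentLQ S ν).closed K t * secondMoment S ν K t.castSucc * ((momentLQ S ν).closed K t)ᵀ
      + (momentLQ S ν).N t := by
  have hX := h.traj_squareIntegrable K t.castSucc
  have hw := h.noise_squareIntegrable t
  set d := augD S t with hd
  set M := augA S t - augB S t * K t with hM
  set Z := secondMoment S ν K t.castSucc with hZ
  set μ := (noiseMean ν t).ofLp with hμ
  have hZt : Zᵀ = Z := transpose_crossMoment _ _
  have hcross := h.crossMoment_traj_noise K t
  rw [integral_traj, ← hZ] at hcross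
  have hcross' := congrArg transpose hcross
  rw [transpose_crossMoment, transpose_vecMulVec] at hcross'
  have h1 : secondMoment S ν K t.succ = M * Z * Mᵀ
      + M * vecMulVec (Z *ᵥ unitVec m) μ * dᵀ + d * vecMulVec μ (Z *ᵥ unitVec m) * Mᵀ
      + d * noiseMoment ν t * dᵀ := by
    change crossMoment (pathLaw S ν) (fun ω => traj S K ω t.succ) (fun ω => traj S K ω t.succ) = _
    simp only [traj_succ]
    rw [crossMoment_add_add (hX.mulVec M) (hw.mulVec d),
      crossMoment_mulVec_left hX (hX.mulVec M), crossMoment_mulVec_right hX hX,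
      crossMoment_mulVec_left hX (hw.mulVec d), crossMoment_mulVec_right hw hX,
      crossMoment_mulVec_left hw (hX.mulVec M), crossMoment_mulVec_right hX hw,
      crossMoment_mulVec_left hw (hw.mulVec d), crossMoment_mulVec_right hw hw,
      h.crossMoment_noise, hcross, hcross']
    simp only [Matrix.mul_assoc]
    rfl
  have hc : (momentLQ S ν).closed K t = M + vecMulVec (d *ᵥ μ) (unitVec m) := by
    simp only [MomentLQ.closed, momentLQ, ← hd, ← hμ, hM]
    abel
  have hN : (momentLQ S ν).N t = d * noiseMoment ν t * dᵀ - vecMulVec (d *ᵥ μ) (d *ᵥ μ) := by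
    simp only [momentLQ, ← hd, ← hμ, Matrix.mul_sub, Matrix.sub_mul, mul_vecMulVec, vecMulVec_mul,
      vecMul_transpose]
  have hvec : unitVec m ᵥ* Z = Z *ᵥ unitVec m := by
    rw [← mulVec_transpose, hZt]
  have hone : (Z *ᵥ unitVec m) ⬝ᵥ unitVec m = 1 := h.secondMoment_unitVec_dotProduct K _
  rw [h1, hc, hN]
  simp only [Matrix.mul_add, Matrix.add_mul, transpose_add, transpose_vecMulVec, mul_vecMulVec,
    vecMulVec_mul, vecMul_transpose, hvec, ← mulVec_mulVec, add_mulVec, add_vecMulVec,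
    vecMulVec_mulVec, hone, MulOpposite.op_one, one_smul]
  abel

theorem moment_eq (t : Fin (T + 1)) : (momentLQ S ν).moment K t = secondMoment S ν K t := by
  induction t using Fin.induction with
  | zero => rfl
  | succ t ih => rw [MomentLQ.moment_succ, ih, h.secondMoment_succ]

theorem secondMoment_posSemidef (t : Fin (T + 1)) : (secondMoment S ν K t).PosSemidef :=
  crossMoment_posSemidef (h.traj_squareIntegrable K t)

theorem cost_eq : cost S ν K = (momentLQ S ν).cost K := by
  have hX := h.traj_squareIntegrable K
  have hu : ∀ t, SquareIntegrable (pathLaw S ν) fun ω => control K t (traj S K ω t.castSucc) := by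
    intro t
    simp only [control, ← neg_mulVec]
    exact (hX t.castSucc).mulVec _
  have hcu : ∀ t : Fin T, crossMoment (pathLaw S ν)
      (fun ω => control K t (traj S K ω t.castSucc))
      (fun ω => control K t (traj S K ω t.castSucc))
      = K t * secondMoment S ν K t.castSucc * (K t)ᵀ := by
    intro t
    have hx := hX t.castSucc
    simp only [control, ← neg_mulVec]
    rw [crossMoment_mulVec_left hx (hx.mulVec _), crossMoment_mulVec_right hx hx]
    simp only [transpose_neg, Matrix.mul_neg, Matrix.neg_mul, neg_neg, Matrix.mul_assoc]
    rfl
  unfold cost pathCost MomentLQ.cost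
  rw [integral_add, integral_finsetSum]
  · congr 1
    · refine Finset.sum_congr rfl fun t _ => ?_
      rw [integral_add ((hX _).integrable_quadratic _) ((hu t).integrable_quadratic _),
        integral_quadratic (hX _), integral_quadratic (hu t), hcu, h.moment_eq]
      rfl
    · rw [integral_quadratic (hX _), h.moment_eq]
      rfl
  · exact fun t _ => ((hX _).integrable_quadratic _).add ((hu t).integrable_quadratic _)
  · exact integrable_finsetSum _ fun t _ =>
      ((hX _).integrable_quadratic _).add ((hu t).integrable_quadratic _)
  · exact (hX _).integrable_quadratic _

theorem grad_eq (t : Fin T) : grad S ν K t = (momentLQ S ν).gradient K t := by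
  have hc : cost S ν = (momentLQ S ν).cost := funext h.cost_eq
  ext i j
  rw [grad, of_apply, hc, MomentLQ.lineDeriv_cost]

end FiniteMoments

end MomentProblem

/-! ### The bounding constant and the stepsize polynomial. -/

theorem one_le_prod_and_le_prod {l : List ℝ} (hl : ∀ x ∈ l, 1 ≤ x) :
    1 ≤ l.prod ∧ ∀ x ∈ l, x ≤ l.prod := by
  induction l with
  | nil => simp
  | cons y l ih =>
    obtain ⟨h1, h2⟩ := ih fun x hx => hl x (List.mem_cons_of_mem _ hx)
    have hy := hl y List.mem_cons_self
    rw [List.prod_cons]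
    refine ⟨by nlinarith, fun x hx => ?_⟩
    rcases List.mem_cons.1 hx with rfl | hx
    · nlinarith
    · nlinarith [h2 x hx]

/-- The parameters other than the two smallest singular values. -/
def upperParams : List Param :=
  [.dimState, .dimControl, .dimNoise, .normA, .normB, .normD, .normQ, .normR, .normNoiseMean,
    .normNoiseMoment, .normInitMoment]

/-- The inverse of the constant that bounds all problem data, as a monomial in the parameters. -/
def scalePoly (T : ℕ) : MvPolynomial StepVar ℝ :=
  MvPolynomial.C (1 / ((T : ℝ) + 2)) * MvPolynomial.X .costRecip
    * (upperParams.map fun θ => MvPolynomial.X (.recip θ)).prod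
    * (MvPolynomial.X (.value .sigX) * MvPolynomial.X (.recip .sigX))
    * (MvPolynomial.X (.value .sigR) * MvPolynomial.X (.recip .sigR))

section Scale

variable {m n k T : ℕ} (S : LQSystem m n k T) (ν : Fin T → Measure (Fin k → ℝ)) (K₀ : Gain m n T)

/-- A constant that bounds all problem data. -/
def scale : ℝ :=
  ((T : ℝ) + 2) * (cost S ν K₀ + 1) * (upperParams.map fun θ => paramVal S ν K₀ θ + 1).prod
    * ((sigmaX S ν K₀ + 1) / sigmaX S ν K₀) * ((sigmaR S + 1) / sigmaR S)

theorem eval_scalePoly : MvPolynomial.eval (stepVal S ν K₀) (scalePoly T) = (scale S ν K₀)⁻¹ := by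
  simp only [scalePoly, scale, upperParams, stepVal, paramVal, map_mul, MvPolynomial.eval_C,
    MvPolynomial.eval_X, List.map_cons, List.map_nil, List.prod_cons, List.prod_nil, mul_inv,
    map_one, inv_one, inv_inv, one_mul, div_eq_mul_inv,
    mul_comm (sigmaX S ν K₀), mul_comm (sigmaR S)]

theorem paramVal_nonneg {θ : Param} (hθ : θ ∈ upperParams) : 0 ≤ paramVal S ν K₀ θ := by
  simp only [upperParams, List.mem_cons, List.not_mem_nil, or_false] at hθ
  rcases hθ with rfl | rfl | rfl | rfl | rfl | rfl | rfl | rfl | rfl | rfl | rfl <;>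
    first
    | exact Nat.cast_nonneg _
    | exact norm_nonneg _
    | exact Real.iSup_nonneg fun _ => norm_nonneg _

theorem bddBelow_sigmaMin_range {α : Type*} {ι : Type} [Fintype ι] [DecidableEq ι]
    (f : α → Matrix ι ι ℝ) : BddBelow (Set.range fun a => sigmaMin (f a)) :=
  ⟨0, by rintro _ ⟨a, rfl⟩; exact sigmaMin_nonneg _⟩

theorem sigmaX_le {K : Gain m n T} (hK : cost S ν K ≤ cost S ν K₀) (t : Fin (T + 1)) :
    sigmaX S ν K₀ ≤ sigmaMin (secondMoment S ν K t) :=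
  ciInf_le (f := fun q : {K : Gain m n T // cost S ν K ≤ cost S ν K₀} × Fin (T + 1) =>
    sigmaMin (secondMoment S ν q.1 q.2)) (bddBelow_sigmaMin_range _) (⟨K, hK⟩, t)

theorem sigmaR_le (t : Fin T) : sigmaR S ≤ sigmaMin (S.R t) :=
  ciInf_le (bddBelow_sigmaMin_range S.R) t

/-- The minimum over time is attained. `hT` excludes an empty infimum, with default value 0, and
`hn` the empty matrix, whose smallest singular value is 0. -/
theorem sigmaR_pos (hT : 0 < T) (hn : 0 < n) : 0 < sigmaR S := by
  have : Nonempty (Fin T) := ⟨⟨0, hT⟩⟩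
  have : Nonempty (Fin n) := ⟨⟨0, hn⟩⟩
  obtain ⟨t, ht⟩ := exists_eq_ciInf_of_finite (f := fun t => sigmaMin (S.R t))
  rw [sigmaR, ← ht]
  exact sigmaMin_pos (S.R_posDef t)

variable {S ν K₀}

/-- Every factor of `scale` is at least 1, so the product dominates each one. The factors (σ+1)/σ
remain at least 1 in total after multiplication by σ_X σ_R, which gives the cost bound. -/
theorem scale_bounds (hX : 0 < sigmaX S ν K₀) (hR : 0 < sigmaR S) :
    (T : ℝ) + 2 ≤ scale S ν K₀ ∧
      cost S ν K₀ ≤ scale S ν K₀ * (sigmaX S ν K₀ * sigmaR S) ∧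
      ∀ θ ∈ upperParams, paramVal S ν K₀ θ ≤ scale S ν K₀ := by
  obtain ⟨h1, h2⟩ := one_le_prod_and_le_prod
    (l := upperParams.map fun θ => paramVal S ν K₀ θ + 1) (by
      intro x hx
      obtain ⟨θ, hθ, rfl⟩ := List.mem_map.1 hx
      linarith [paramVal_nonneg S ν K₀ hθ])
  have hC : 1 ≤ cost S ν K₀ + 1 := by linarith [cost_nonneg (S := S) (ν := ν) K₀]
  have hT : 1 ≤ (T : ℝ) + 2 := by linarith [Nat.cast_nonneg (α := ℝ) T]
  set L := (upperParams.map fun θ => paramVal S ν K₀ θ + 1).prod with hL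
  set x := sigmaX S ν K₀
  set r := sigmaR S
  have hx : 1 ≤ (x + 1) / x := by rw [le_div_iff₀ hX]; linarith
  have hr : 1 ≤ (r + 1) / r := by rw [le_div_iff₀ hR]; linarith
  have hs : scale S ν K₀
      = ((T : ℝ) + 2) * (cost S ν K₀ + 1) * L * ((x + 1) / x) * ((r + 1) / r) := rfl
  have b1 : 1 ≤ ((T : ℝ) + 2) * (cost S ν K₀ + 1) := one_le_mul_of_one_le_of_one_le hT hC
  have b2 := one_le_mul_of_one_le_of_one_le b1 h1
  have b3 := one_le_mul_of_one_le_of_one_le b2 hx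
  have e4 := le_mul_of_one_le_right (zero_le_one.trans b3) hr
  have e3 := le_mul_of_one_le_right (zero_le_one.trans b2) hx
  have e2 := le_mul_of_one_le_right (zero_le_one.trans b1) h1
  have e1 := le_mul_of_one_le_right (zero_le_one.trans hT) hC
  have eL := le_mul_of_one_le_left (zero_le_one.trans h1) b1
  rw [← hs] at e4
  refine ⟨by linarith, ?_, fun θ hθ => ?_⟩
  · have h3 : scale S ν K₀ * (x * r)
        = ((T : ℝ) + 2) * (cost S ν K₀ + 1) * L * ((x + 1) * (r + 1)) := by
      rw [hs]; field_simp
    have h4 : 1 ≤ (x + 1) * (r + 1) := by nlinarith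
    have h5 := le_mul_of_one_le_right (zero_le_one.trans b2) h4
    have h6 := le_mul_of_one_le_left (zero_le_one.trans hC) hT
    rw [h3]
    linarith
  · have := h2 _ (List.mem_map.2 ⟨θ, hθ, rfl⟩)
    linarith

theorem scale_isBoundedBy (hT : 0 < T) (hX : 0 < sigmaX S ν K₀) (hR : 0 < sigmaR S) :
    (momentLQ S ν).IsBoundedBy (scale S ν K₀) := by
  obtain ⟨hs, -, hp⟩ := scale_bounds hX hR
  have hT1 : (1 : ℝ) ≤ T := by exact_mod_cast hT
  have h3 : 3 ≤ scale S ν K₀ := by linarith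
  have sup_le : ∀ {α : Type} [Finite α] (f : α → ℝ) (a : α) (θ : Param), θ ∈ upperParams →
      paramVal S ν K₀ θ = ⨆ a, f a → f a ≤ scale S ν K₀ ^ 1 := by
    intro α _ f a θ hθ he
    rw [pow_one]
    exact (le_ciSup (Set.finite_range f).bddAbove a).trans (he ▸ hp θ hθ)
  have hA := fun t => sup_le (fun t => ‖augA S t‖) t .normA (by simp [upperParams]) rfl
  have hB := fun t => sup_le (fun t => ‖augB S t‖) t .normB (by simp [upperParams]) rfl
  have hD := fun t => sup_le (fun t => ‖augD S t‖) t .normD (by simp [upperParams]) rfl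
  have hQ := fun t => sup_le (fun t => ‖augQ S t‖) t .normQ (by simp [upperParams]) rfl
  have hR := fun t => sup_le (fun t => ‖S.R t‖) t .normR (by simp [upperParams]) rfl
  have hμ := fun t =>
    sup_le (fun t => ‖noiseMean ν t‖) t .normNoiseMean (by simp [upperParams]) rfl
  have hW := fun t =>
    sup_le (fun t => ‖noiseMoment ν t‖) t .normNoiseMoment (by simp [upperParams]) rfl
  refine ⟨h3, by linarith, ?_, fun t => ?_, hB, fun t => ?_, hQ, hR, ?_⟩
  · rw [Fintype.card_fin]
    exact hp .dimControl (by simp [upperParams])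
  · refine norm_add_le_pow (b := 2) h3 (hA t) ?_ (by norm_num) le_rfl
    have hu : ‖WithLp.toLp 2 (unitVec m)‖ = 1 := by simp [unitVec]
    refine (norm_vecMulVec_le _ _).trans ?_
    rw [hu, mul_one, pow_two]
    refine (norm_mulVec_le _ _).trans ?_
    have h1 := hD t
    have h2 := hμ t
    rw [pow_one] at h1 h2
    exact mul_le_mul h1 h2 (norm_nonneg _) (by linarith)
  · refine norm_mul_le_pow (a := 4) (b := 1) (norm_mul_le_pow (b := 3) (hD t) ?_)
      (norm_transpose_le (hD t))
    refine norm_sub_le_pow (b := 2) h3 (hW t) ?_ (by norm_num) le_rfl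
    refine (norm_vecMulVec_le _ _).trans ?_
    have h2 := hμ t
    rw [pow_one] at h2
    rw [pow_two]
    exact mul_le_mul h2 h2 (norm_nonneg _) (by linarith)
  · rw [pow_one]
    exact hp .normInitMoment (by simp [upperParams])

theorem stepsize_eq (N : ℕ) :
    stepsize S ν K₀ (scalePoly T ^ N) = (scale S ν K₀)⁻¹ ^ N := by
  rw [stepsize, map_pow, eval_scalePoly]

theorem FiniteMoments.stepCondition (h : FiniteMoments S ν) (hT : 0 < T) (hn : 0 < n)
    (hX : 0 < sigmaX S ν K₀) :
    (momentLQ S ν).StepCondition K₀ (scale S ν K₀) (sigmaX S ν K₀) (sigmaR S)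
      (stepsize S ν K₀ (scalePoly T ^ (27 * T + 19))) := by
  have hR := sigmaR_pos S hT hn
  have hb := scale_isBoundedBy hT hX hR
  refine ⟨hb, fun K t => ?_, hX, hR, fun K hK t => ?_, sigmaR_le S, ?_, ?_, ?_⟩
  · rw [h.moment_eq]
    exact h.secondMoment_posSemidef K t
  · rw [← h.cost_eq, ← h.cost_eq] at hK
    rw [h.moment_eq]
    exact sigmaX_le S ν K₀ hK t
  · rw [← h.cost_eq]
    exact (scale_bounds hX hR).2.1
  · rw [stepsize_eq]
    exact pow_pos (inv_pos.2 hb.pos) _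
  · rw [stepsize_eq, ← mul_pow, inv_mul_cancel₀ hb.pos.ne', one_pow]

theorem FiniteMoments.globallyConverges (h : FiniteMoments S ν) {θ η : ℝ}
    (hc : (momentLQ S ν).StepCondition K₀ θ (sigmaX S ν K₀) (sigmaR S) η) :
    GloballyConverges S ν K₀ η := by
  have hstep : ∀ i, iter S ν η K₀ (i + 1)
      = fun t => iter S ν η K₀ i t - η • (momentLQ S ν).gradient (iter S ν η K₀ i) t := by
    intro i
    funext t
    simp only [iter, h.grad_eq]
  -- The iterates stay in the initial sublevel set, so the same constants apply at every step.
  have hinv : ∀ i, (momentLQ S ν).cost (iter S ν η K₀ i) ≤ (momentLQ S ν).cost K₀ := by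
    intro i
    induction i with
    | zero => exact le_rfl
    | succ i ih =>
      rw [hstep]
      exact hc.step_cost_le ih
  refine ⟨?_, fun Kstar hopt => ?_⟩
  · obtain ⟨K, hK⟩ := hc.exists_optimal
    exact ⟨K, fun K' => by rw [h.cost_eq, h.cost_eq]; exact hK K'⟩
  have hagg : ∑ t, (momentLQ S ν).moment Kstar t = aggMoment S ν Kstar :=
    Finset.sum_congr rfl fun t _ => h.moment_eq Kstar t
  have hcontr : ∀ i : ℕ, cost S ν (iter S ν η K₀ (i + 1)) - cost S ν Kstar ≤
      (1 - 2 * η * (sigmaX S ν K₀ ^ 2 * sigmaR S / (‖aggMoment S ν Kstar‖ + 1))) *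
        (cost S ν (iter S ν η K₀ i) - cost S ν Kstar) := by
    intro i
    have := hc.contraction (K' := Kstar) (hinv i)
    rwa [hagg, ← hstep, ← h.cost_eq, ← h.cost_eq, ← h.cost_eq] at this
  refine ⟨hcontr, fun ε hε N hN => ?_⟩
  have hX := hc.sigX_pos
  have hR := hc.sigR_pos
  have hη := hc.step_pos
  refine le_of_geometric_decay (g := fun i => cost S ν (iter S ν η K₀ i) - cost S ν Kstar)
    (fun i => sub_nonneg.2 (hopt _)) (by positivity) hcontr hε (le_trans (le_of_eq ?_) hN)
  have hs : 0 < ‖aggMoment S ν Kstar‖ + 1 := by positivity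
  congr 1
  field_simp

end Scale

/-! ### Empirical laws and the conclusion. -/

section Empirical

variable {k M : ℕ}

theorem isProbabilityMeasure_empirical (hM : 0 < M) (w : Fin M → Fin k → ℝ) :
    IsProbabilityMeasure (empirical w) := by
  refine ⟨?_⟩
  simp only [empirical, Measure.smul_apply, Measure.finsetSum_apply, measure_univ,
    Finset.sum_const, Finset.card_univ, Fintype.card_fin, nsmul_eq_mul, mul_one, smul_eq_mul]
  exact ENNReal.inv_mul_cancel (by exact_mod_cast hM.ne') (ENNReal.natCast_ne_top M)

theorem memLp_empirical (hM : 0 < M) (w : Fin M → Fin k → ℝ) (j : Fin k) :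
    MemLp (fun w : Fin k → ℝ => w j) 2 (empirical w) := by
  rw [memLp_two_iff_integrable_sq (measurable_pi_apply j).aestronglyMeasurable]
  refine Integrable.smul_measure ?_ (ENNReal.inv_ne_top.2 (by exact_mod_cast hM.ne'))
  rw [integrable_finsetSum_measure]
  exact fun i _ => integrable_dirac (by simp)

end Empirical

end AffineLQ

end

theorem theorem3 (T : ℕ) (hT : 0 < T) :
    ∃ p : MvPolynomial AffineLQ.StepVar ℝ,
      ∀ (m n k : ℕ) (_hn : 0 < n) (S : AffineLQ.LQSystem m n k T) (K₀ : AffineLQ.Gain m n T),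
        -- for any square integrable noise law, in particular for the empirical law of any sample
        (∀ ν : Fin T → Measure (Fin k → ℝ), (∀ t, IsProbabilityMeasure (ν t)) →
          (∀ t j, MemLp (fun w : Fin k → ℝ => w j) 2 (ν t)) →
          AffineLQ.FiniteCost S ν K₀ → 0 < AffineLQ.sigmaX S ν K₀ →
            0 < AffineLQ.stepsize S ν K₀ p ∧
              AffineLQ.GloballyConverges S ν K₀ (AffineLQ.stepsize S ν K₀ p)) ∧
        -- for the empirical law of a random sample `ŵ t 0, …, ŵ t (M - 1)` with law `P ^ M`
        (∀ (M : ℕ) (_hM : 0 < M) (P : Measure (Fin k → ℝ)) (_hP : IsProbabilityMeasure P)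
          (ℙ : Measure (Fin T → Fin M → Fin k → ℝ)) (_hℙ : IsProbabilityMeasure ℙ)
          (_hsample : ∀ t, ℙ.map (fun ŵ => ŵ t) = Measure.pi (fun _ : Fin M => P))
          (_hfin : ∀ᵐ ŵ ∂ℙ,
            AffineLQ.FiniteCost S (fun t => AffineLQ.empirical (ŵ t)) K₀)
          (_hpos : ∀ᵐ ŵ ∂ℙ, 0 < AffineLQ.sigmaX S (fun t => AffineLQ.empirical (ŵ t)) K₀)
          (β : ℝ) (_hβ : 0 < β) (_hβ' : β < 1),
          ENNReal.ofReal (1 - β) <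
            ℙ {ŵ | 0 < AffineLQ.stepsize S (fun t => AffineLQ.empirical (ŵ t)) K₀ p ∧
              AffineLQ.GloballyConverges S (fun t => AffineLQ.empirical (ŵ t)) K₀
                (AffineLQ.stepsize S (fun t => AffineLQ.empirical (ŵ t)) K₀ p)}) := by
  have general : ∀ (m n k : ℕ), 0 < n → ∀ (S : AffineLQ.LQSystem m n k T)
      (K₀ : AffineLQ.Gain m n T) (ν : Fin T → Measure (Fin k → ℝ)),
      (∀ t, IsProbabilityMeasure (ν t)) →
      (∀ t j, MemLp (fun w : Fin k → ℝ => w j) 2 (ν t)) →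
      AffineLQ.FiniteCost S ν K₀ → 0 < AffineLQ.sigmaX S ν K₀ →
        0 < AffineLQ.stepsize S ν K₀ (AffineLQ.scalePoly T ^ (27 * T + 19)) ∧
          AffineLQ.GloballyConverges S ν K₀
            (AffineLQ.stepsize S ν K₀ (AffineLQ.scalePoly T ^ (27 * T + 19))) := by
    intro m n k hn S K₀ ν hp hν hfin hX
    have h := hfin.finiteMoments hp hν
    have hc := h.stepCondition hT hn hX
    exact ⟨hc.step_pos, h.globallyConverges hc⟩
  refine ⟨AffineLQ.scalePoly T ^ (27 * T + 19), fun m n k hn S K₀ =>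
    ⟨general m n k hn S K₀, ?_⟩⟩
  intro M hM P _ ℙ _ _ hfin hpos β hβ _
  have hae : ∀ᵐ ŵ ∂ℙ, 0 < AffineLQ.stepsize S (fun t => AffineLQ.empirical (ŵ t)) K₀
      (AffineLQ.scalePoly T ^ (27 * T + 19)) ∧
      AffineLQ.GloballyConverges S (fun t => AffineLQ.empirical (ŵ t)) K₀
        (AffineLQ.stepsize S (fun t => AffineLQ.empirical (ŵ t)) K₀
          (AffineLQ.scalePoly T ^ (27 * T + 19))) := by
    filter_upwards [hfin, hpos] with ŵ h1 h2
    exact general m n k hn S K₀ _ (fun t => AffineLQ.isProbabilityMeasure_empirical hM (ŵ t))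
      (fun t j => AffineLQ.memLp_empirical hM (ŵ t) j) h1 h2
  -- The event agrees almost everywhere with the whole space, so its measure is 1 > 1 - β; its
  -- measurability is not needed.
  rw [measure_congr (Filter.eventuallyEq_univ.2 hae), measure_univ, ENNReal.ofReal_lt_one]
  linarith
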